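/- **Notation.** Let $\mathcal S_\infty$ be the group of permutations of $\{1,2,\dots\}$ that fix all but finitely many numbers (product = composition), and let $\ell(u)$ be the number of inversions of $u$. For $k\ge 0$, the $k$-Bruhat order $\le_k$ on $\mathcal S_\infty$ is the partial order whose covers are $u<_k u(a\,b)$ with $a\le k<b$ and $\ell(u(a\,b))=\ell(u)+1$. The universal $k$-Bruhat order is defined by: $\eta\preceq\zeta$ iff there are $u\in\mathcal S_\infty$ and $k$ with $u\le_k\eta u\le_k\zeta u$. Write $[u,w]_k$ and $[\eta,\zeta]_\preceq$ for intervals. Let $\mathcal M$ be the monoid with $0$ generated by $\mathbf u_{\alpha\beta}$ ($0<\alpha<\beta$ integers) subject to the relations (1.1): 1. $\mathbf u_{\beta\gamma}\mathbf u_{\gamma\delta}\mathbf u_{\alpha\gamma}=\mathbf u_{\beta\delta}\mathbf u_{\alpha\beta}\mathbf u_{\beta\gamma}$ if $\alpha<\beta<\gamma<\delta$; 2. $\mathbf u_{\alpha\gamma}\mathbf u_{\gamma\delta}\mathbf u_{\beta\gamma}=\mathbf u_{\beta\gamma}\mathbf u_{\alpha\beta}\mathbf u_{\beta\delta}$ if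 $\alpha<\beta<\gamma<\delta$; 3. $\mathbf u_{\alpha\beta}\mathbf u_{\gamma\delta}=\mathbf u_{\gamma\delta}\mathbf u_{\alpha\beta}$ if $\alpha<\beta<\gamma<\delta$ or $\alpha<\gamma<\delta<\beta$; 4. $\mathbf u_{\alpha\gamma}\mathbf u_{\beta\delta}=\mathbf u_{\beta\delta}\mathbf u_{\alpha\gamma}=0$ if $\alpha\le\beta<\gamma\le\delta$; 5. $\mathbf u_{\beta\gamma}\mathbf u_{\alpha\beta}\mathbf u_{\beta\gamma}=\mathbf u_{\alpha\beta}\mathbf u_{\beta\gamma}\mathbf u_{\alpha\beta}=0$ if $\alpha<\beta<\gamma$. Let $\hat{\mathbf u}_{\alpha\beta}$ be the linear operator on the $\mathbb Q$-vector space $\mathbb Q\mathcal S_\infty$ with basis $\mathcal S_\infty$ given by $\hat{\mathbf u}_{\alpha\beta}\zeta=(\alpha\,\beta)\zeta$ if $(\alpha\,\beta)\zeta$ covers $\zeta$ in $\preceq$, and $\hat{\mathbf u}_{\alpha\beta}\zeta=0$ otherwise. **Theorem.** (a) For each $\zeta\in\mathcal S_\infty$ there are $u\in\mathcal S_\infty$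 and $k$ with $u\le_k\zeta u$, and the number $\ell_{\mathbf u}(\zeta):=\ell(\zeta u)-\ell(u)\in\mathbb N$ is the same for all such $u,k$. (b) The operators $\hat{\mathbf u}_{\alpha\beta}$ satisfy the relations (1.1). Two compositions $\hat{\mathbf u}_{\alpha'_m\beta'_m}\cdots\hat{\mathbf u}_{\alpha'_1\beta'_1}$ and $\hat{\mathbf u}_{\alpha_n\beta_n}\cdots\hat{\mathbf u}_{\alpha_1\beta_1}$ are equal if and only if they take the same value at the identity $1\in\mathcal S_\infty$. (c) There is a homomorphism of monoids with zero $\mathbf x\mapsto\hat{\mathbf x}$ from $\mathcal M$ to $\operatorname{End}_{\mathbb Q}(\mathbb Q\mathcal S_\infty)$ with $\mathbf u_{\alpha\beta}\mapsto\hat{\mathbf u}_{\alpha\beta}$, and it is injective (a faithful representation of $\mathcal M$). (d) The map $\mathbf x\mapsto\hat{\mathbf x}1$ is a bijection from $\mathcal M$ onto $\mathcal S_\infty\cup\{0\}\subset\mathbb Q\mathcal S_\infty$. (e) The relation $\preceq$ is a partial order on $\mathcal S_\infty$, ranked by $\ell_{\mathbf u}$: the function $\ell_{\mathbf u}$ is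 strictly increasing, increases by exactly $1$ along covers, and vanishes at minimal elements. One has $\eta\preceq\zeta$ if and only if $\zeta=\hat{\mathbf x}\eta$ for some $\mathbf x\in\mathcal M$. If $u\le_k\zeta u$, then $\xi\mapsto\xi u$ is an isomorphism of ordered sets $[1,\zeta]_\preceq\cong[u,\zeta u]_k$. If $\eta\preceq\zeta$, then $\xi\mapsto\xi\eta$ is an isomorphism of ordered sets $[1,\zeta\eta^{-1}]_\preceq\cong[\eta,\zeta]_\preceq$. (f) For each $\zeta\in\mathcal S_\infty$, sending a sequence $(\alpha_n\beta_n),\dots,(\alpha_1\beta_1)$ with $\hat{\mathbf u}_{\alpha_n\beta_n}\cdots\hat{\mathbf u}_{\alpha_1\beta_1}1=\zeta$ to the set $\{\hat{\mathbf u}_{\alpha_i\beta_i}\cdots\hat{\mathbf u}_{\alpha_1\beta_1}1: 0\le i\le n\}$ is a bijection from the set of all such sequences onto the set of maximal chains of $[1,\zeta]_\preceq$. -/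

import Mathlib

/-- The infinite symmetric group: permutations of `{1, 2, 3, …}` fixing all but finitely many
numbers.  The product is composition of functions. -/
def SInf : Subgroup (Equiv.Perm ℕ+) where
  carrier := {σ | {i | σ i ≠ i}.Finite}
  one_mem' := by simp
  mul_mem' := by
    intro σ τ hσ hτ
    refine (Set.Finite.union hσ hτ).subset ?_
    intro i hi
    by_contra h
    simp only [Set.mem_union, Set.mem_ofPred_eq, not_or, not_not] at h
    apply hi
    rw [Equiv.Perm.mul_apply, h.2, h.1]
  inv_mem' := by
    intro σ hσ
    refine Set.Finite.subset hσ ?_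
    intro i hi h
    apply hi
    rw [Equiv.Perm.inv_eq_iff_eq]
    exact h.symm

theorem swap_mem_SInf (a b : ℕ+) : Equiv.swap a b ∈ SInf := by
  refine ((Set.finite_singleton b).insert a).subset ?_
  intro i hi
  by_contra h
  simp only [Set.mem_insert_iff, Set.mem_singleton_iff, not_or] at h
  exact hi (Equiv.swap_apply_of_ne_of_ne h.1 h.2)

/-- The transposition `(a b)` as an element of the infinite symmetric group. -/
def transp (a b : ℕ+) : SInf := ⟨Equiv.swap a b, swap_mem_SInf a b⟩

/-- The length `ℓ(u)` of a permutation: its number of inversions. -/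
noncomputable def permLength (u : SInf) : ℕ :=
  {p : ℕ+ × ℕ+ | p.1 < p.2 ∧ u.1 p.2 < u.1 p.1}.ncard

/-- Covering relation of the `k`-Bruhat order: `w = u (a b)` with `a ≤ k < b`
and `ℓ(w) = ℓ(u) + 1`. -/
def KCover (k : ℕ) (u w : SInf) : Prop :=
  ∃ a b : ℕ+, (a : ℕ) ≤ k ∧ k < (b : ℕ) ∧ w = u * transp a b ∧
    permLength w = permLength u + 1

/-- The `k`-Bruhat order `u ≤ₖ w`. -/
def KLE (k : ℕ) : SInf → SInf → Prop := Relation.ReflTransGen (KCover k)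

/-- The universal `k`-Bruhat order `η ≼ ζ`: there are `u` and `k` with `u ≤ₖ η u ≤ₖ ζ u`. -/
def UBLE (η ζ : SInf) : Prop :=
  ∃ (u : SInf) (k : ℕ), KLE k u (η * u) ∧ KLE k (η * u) (ζ * u)

/-- The function `ℓ_u(ζ) = ℓ(ζ u) - ℓ(u)`, for `u` and `k` with `u ≤ₖ ζ u`.  To have a
definition before independence of `u` and `k` is known, the least `n` that arises is taken. -/
noncomputable def rankU (ζ : SInf) : ℕ :=
  sInf {n | ∃ (u : SInf) (k : ℕ), KLE k u (ζ * u) ∧ permLength (ζ * u) = permLength u + n}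

/-- `b` covers `a` in the order relation `r`. -/
def RelCovers {α : Type*} (r : α → α → Prop) (a b : α) : Prop :=
  r a b ∧ a ≠ b ∧ ∀ c, r a c → r c b → c = a ∨ c = b

/-- The interval `[a, b]` of the order relation `r`. -/
def relInterval {α : Type*} (r : α → α → Prop) (a b : α) : Set α := {c | r a c ∧ r c b}

/-- The order relation `r` is ranked by `f`. -/
structure IsRankedBy {α : Type*} (r : α → α → Prop) (f : α → ℕ) : Prop where
  strict : ∀ a b, r a b → a ≠ b → f a < f b
  covers : ∀ a b, RelCovers r a b → f b = f a + 1
  minimal : ∀ a, (∀ b, r b a → b = a) → f a = 0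

/-- The maximal chains of the interval `[a, b]` of `r`, as sets of elements. -/
def maximalChains {α : Type*} (r : α → α → Prop) (a b : α) : Set (Set α) :=
  {C | Maximal (fun D : Set α => D ⊆ relInterval r a b ∧ IsChain r D) C}

/-- The index set of the generators: pairs of integers `0 < α < β`. -/
abbrev GenIdx : Type := {p : ℕ+ × ℕ+ // p.1 < p.2}

/-- The index `(α, β)`, where `α < β`. -/
def genIdx {α β : ℕ+} (h : α < β) : GenIdx := ⟨(α, β), h⟩

/-- The pairs of elements of `N` that the defining relations identify, for a family `v` of
elements `v_{αβ}` of a monoid `N` with zero. -/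
inductive MRel {N : Type*} [MonoidWithZero N] (v : GenIdx → N) : N → N → Prop
  | rel1 {α β γ δ : ℕ+} (h₁ : α < β) (h₂ : β < γ) (h₃ : γ < δ) :
      MRel v
        (v (genIdx h₂) * v (genIdx h₃) * v (genIdx (h₁.trans h₂)))
        (v (genIdx (h₂.trans h₃)) * v (genIdx h₁) * v (genIdx h₂))
  | rel2 {α β γ δ : ℕ+} (h₁ : α < β) (h₂ : β < γ) (h₃ : γ < δ) :
      MRel v
        (v (genIdx (h₁.trans h₂)) * v (genIdx h₃) * v (genIdx h₂))
        (v (genIdx h₂) * v (genIdx h₁) * v (genIdx (h₂.trans h₃)))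
  | rel3 {α β γ δ : ℕ+} (h₁ : α < β) (h₂ : γ < δ) (h : β < γ ∨ (α < γ ∧ δ < β)) :
      MRel v
        (v (genIdx h₁) * v (genIdx h₂))
        (v (genIdx h₂) * v (genIdx h₁))
  | rel4 {α β γ δ : ℕ+} (h₁ : α ≤ β) (h₂ : β < γ) (h₃ : γ ≤ δ) :
      MRel v (v (genIdx (h₁.trans_lt h₂)) * v (genIdx (h₂.trans_le h₃))) 0
  | rel4' {α β γ δ : ℕ+} (h₁ : α ≤ β) (h₂ : β < γ) (h₃ : γ ≤ δ) :
      MRel v (v (genIdx (h₂.trans_le h₃)) * v (genIdx (h₁.trans_lt h₂))) 0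
  | rel5 {α β γ : ℕ+} (h₁ : α < β) (h₂ : β < γ) :
      MRel v (v (genIdx h₂) * v (genIdx h₁) * v (genIdx h₂)) 0
  | rel5' {α β γ : ℕ+} (h₁ : α < β) (h₂ : β < γ) :
      MRel v (v (genIdx h₁) * v (genIdx h₂) * v (genIdx h₁)) 0

/-- The free generators of the free monoid with zero on the index set. -/
def freeGen (g : GenIdx) : WithZero (FreeMonoid GenIdx) := (FreeMonoid.of g : FreeMonoid GenIdx)

/-- The congruence on the free monoid with zero generated by the defining relations. -/
def mCon : Con (WithZero (FreeMonoid GenIdx)) := conGen (MRel freeGen)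

/-- The monoid with zero presented by the generators `u_{αβ}` and the defining relations. -/
def MMonoid : Type := mCon.Quotient

instance : Monoid MMonoid := inferInstanceAs (Monoid mCon.Quotient)

/-- The quotient map onto the presented monoid. -/
def MMonoid.mk : WithZero (FreeMonoid GenIdx) →* MMonoid := mCon.mk'

theorem MMonoid.mk_surjective : Function.Surjective MMonoid.mk := mCon.mk'_surjective

instance : MonoidWithZero MMonoid where
  zero := MMonoid.mk 0
  zero_mul x := by
    obtain ⟨y, rfl⟩ := MMonoid.mk_surjective x
    change MMonoid.mk 0 * MMonoid.mk y = MMonoid.mk 0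
    rw [← map_mul, zero_mul]
  mul_zero x := by
    obtain ⟨y, rfl⟩ := MMonoid.mk_surjective x
    change MMonoid.mk y * MMonoid.mk 0 = MMonoid.mk 0
    rw [← map_mul, mul_zero]

/-- The generator `u_{αβ}` of the presented monoid. -/
def MMonoid.gen (g : GenIdx) : MMonoid := MMonoid.mk (freeGen g)

/-- The vector space `ℚ S_∞` with basis the infinite symmetric group. -/
abbrev QSInf : Type := SInf →₀ ℚ

/-- The basis vector of `ℚ S_∞` given by a permutation. -/
noncomputable def basisVec (ζ : SInf) : QSInf := Finsupp.single ζ 1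

open Classical in
/-- The operator `û_{αβ}`: it sends `ζ` to `(α β) ζ` if `(α β) ζ` covers `ζ` in the universal
`k`-Bruhat order, and to `0` otherwise. -/
noncomputable def uHat (g : GenIdx) : Module.End ℚ QSInf :=
  Finsupp.linearCombination ℚ fun ζ : SInf =>
    if RelCovers UBLE ζ (transp g.1.1 g.1.2 * ζ) then basisVec (transp g.1.1 g.1.2 * ζ) else 0

/-- The composition `û_{α_n β_n} ⋯ û_{α_1 β_1}` of the word `[(α_n, β_n), …, (α_1, β_1)]`. -/
noncomputable def hatWord (w : List GenIdx) : Module.End ℚ QSInf := (w.map uHat).prod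

/-- The reduced sequences of `ζ`: the words whose composition sends `1` to `ζ`. -/
def reducedSeqs (ζ : SInf) : Set (List GenIdx) := {w | hatWord w (basisVec 1) = basisVec ζ}

/-- The set of permutations `û_{α_i β_i} ⋯ û_{α_1 β_1} 1`, for `0 ≤ i ≤ n`, obtained from the
word `[(α_n, β_n), …, (α_1, β_1)]`. -/
def wordChain (w : List GenIdx) : Set SInf :=
  {σ | ∃ v, v <:+ w ∧ hatWord v (basisVec 1) = basisVec σ}

/-! The whole theorem rests on one local condition. If u ≤ₖ ζu, a step from ζu to (α β)ζu inside a
k-Bruhat interval above u is governed by `UpStep` for x = ζ⁻¹, a condition that involves neither u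
nor k. `BruhatCrit.step` and `BruhatCrit.unstep` prove this with the help of a criterion for ≤ₖ in
terms of values. Hence the words labelling chains of up steps from η to ζ are exactly the words
labelling k-Bruhat chains from ηu to ζu (`isPath_and_crit_iff`).

A suitable sorting of the numbers gives a base u for every ζ (`exists_bruhatCrit`). So ℓ_u(ζ) is the
length of any word from 1 to ζ, and the order, its rank, its intervals and its maximal chains can be
read off from words. Taking ηu as a new base shows that, for η ≼ ζ, a word leads from η to ζ iff it
leads from 1 to ζη⁻¹ (`isPath_translate`). Therefore a composition of operators is determined by its
value at 1.

Two facts settle the monoid. By `hasUniqueWord`, all chains from 1 to ζ have words with the same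
value in the monoid. The proof is an induction on rank that compares every top label with the
leftmost down step: two such labels commute, or share an endpoint, and then a pigeonhole argument
finds the fourth index needed for relation 1 or 2. By `wordM_eq_zero`, a word that labels no chain
is 0. If g fails to be an up step from ζ and v is a chain to ζ, then v may be replaced by any other
chain to ζ. If gv were nonzero, every top label of ζ would abut g, and g would be an up step once
any atom is removed. The extreme top labels and atoms make this impossible.

So the monoid consists of 0 and one element for each permutation, and these are separated by their
values at 1. -/

/-! ### Inversions and the covering condition -/

/-- The inversions of a permutation of the positive integers. -/
def inversions (w : Equiv.Perm ℕ+) : Set (ℕ+ × ℕ+) := {p | p.1 < p.2 ∧ w p.2 < w p.1}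

theorem exists_bound (u : SInf) : ∃ N : ℕ+, ∀ i, N < i → u.1 i = i := by
  obtain ⟨N, hN⟩ := (u.2 : Set.Finite _).bddAbove
  refine ⟨N, fun i hi => ?_⟩
  by_contra h
  exact absurd (hN h) (not_le.2 hi)

theorem finite_inversions (u : SInf) : (inversions u.1).Finite := by
  obtain ⟨N, hN⟩ := exists_bound u
  refine ((Set.finite_Iic N).prod (Set.finite_Iic N)).subset ?_
  rintro ⟨p, q⟩ ⟨h1, h2⟩
  simp only at h1 h2
  have hlt : ∀ i, i ≤ N → u.1 i ≤ N := by
    intro i hi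
    by_contra h
    push Not at h
    have := u.1.injective (hN _ h)
    rw [this] at h
    exact absurd hi (not_le.2 h)
  have hq : q ≤ N := by
    by_contra h
    push Not at h
    rw [hN q h] at h2
    rcases le_or_gt p N with hp | hp
    · exact absurd ((h.trans h2).trans_le (hlt p hp)) (lt_irrefl _)
    · rw [hN p hp] at h2
      exact lt_asymm h1 h2
  exact ⟨(h1.le.trans hq), hq⟩

/-- The inversions of `w (a b)` that do not come from inversions of `w`. -/
def newInversions (w : Equiv.Perm ℕ+) (a b : ℕ+) : Set (ℕ+ × ℕ+) :=
  {p | p = (a, b) ∨ ∃ c, a < c ∧ c < b ∧ w a < w c ∧ w c < w b ∧ (p = (a, c) ∨ p = (c, b))}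

open Classical in
/-- Transport of an inversion of `w` to an inversion of `w (a b)`. -/
noncomputable def transportInversion (a b : ℕ+) (p : ℕ+ × ℕ+) : ℕ+ × ℕ+ :=
  if Equiv.swap a b p.1 < Equiv.swap a b p.2 then (Equiv.swap a b p.1, Equiv.swap a b p.2) else p

theorem transportInversion_injOn {w : Equiv.Perm ℕ+} {a b : ℕ+} (hab : a < b) (hw : w a < w b) :
    Set.InjOn (transportInversion a b) (inversions w) := by
  rintro ⟨p, q⟩ ⟨h1, h2⟩ ⟨r, s⟩ ⟨h3, h4⟩ h
  simp only [transportInversion, Equiv.swap_apply_def] at h h1 h2 h3 h4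
  simp only [Prod.mk.injEq]
  have e1 : ∀ i j, w i = w j → i = j := fun i j h => w.injective h
  grind

/-- Moving both positions of a pair by (a b) preserves its values. When this reverses the order of
the positions, the pair itself stays an inversion because w a < w b. What is left over are the
inversions created by raising the value at a and lowering the value at b. -/
theorem inversions_mul_swap {w : Equiv.Perm ℕ+} {a b : ℕ+} (hab : a < b) (hw : w a < w b) :
    inversions (w * Equiv.swap a b) =
      transportInversion a b '' inversions w ∪ newInversions w a b := by
  ext ⟨p, q⟩
  have e1 : ∀ i j, w i = w j → i = j := fun i j h => w.injective h
  constructor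
  · rintro ⟨h1, h2⟩
    simp only [Equiv.Perm.mul_apply] at h1 h2
    by_cases h : Equiv.swap a b p < Equiv.swap a b q
    · left
      exact ⟨(Equiv.swap a b p, Equiv.swap a b q), ⟨h, h2⟩, by simp [transportInversion, h1]⟩
    · by_cases h' : w q < w p
      · left
        exact ⟨(p, q), ⟨h1, h'⟩, by simp [transportInversion, h]⟩
      · right
        simp only [newInversions, Set.mem_ofPred_eq, Prod.mk.injEq]
        simp only [Equiv.swap_apply_def] at h h2
        by_cases hp : p = a
        · by_cases hq : q = b
          · exact Or.inl ⟨hp, hq⟩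
          · right; refine ⟨q, ?_⟩; grind
        · right; refine ⟨p, ?_⟩; grind
  · rintro (⟨⟨r, s⟩, ⟨h1, h2⟩, h3⟩ | h)
    · simp only at h1 h2
      simp only [transportInversion] at h3
      simp only [inversions, Set.mem_ofPred_eq, Equiv.Perm.mul_apply]
      split_ifs at h3 with h
      · simp only [Prod.mk.injEq] at h3
        rw [← h3.1, ← h3.2]
        simp [h, h2]
      · simp only [Prod.mk.injEq] at h3
        rw [← h3.1, ← h3.2]
        simp only [Equiv.swap_apply_def] at h ⊢
        grind
    · simp only [newInversions, Set.mem_ofPred_eq, Prod.mk.injEq] at h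
      simp only [inversions, Set.mem_ofPred_eq, Equiv.Perm.mul_apply, Equiv.swap_apply_def]
      grind

theorem disjoint_transport_newInversions {w : Equiv.Perm ℕ+} {a b : ℕ+} (hab : a < b)
    (hw : w a < w b) :
    Disjoint (transportInversion a b '' inversions w) (newInversions w a b) := by
  rw [Set.disjoint_left]
  rintro _ ⟨⟨r, s⟩, ⟨h1, h2⟩, rfl⟩ h
  simp only [newInversions, Set.mem_ofPred_eq, transportInversion, Equiv.swap_apply_def] at h h1 h2
  have e1 : ∀ i j, w i = w j → i = j := fun i j h => w.injective h
  grind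

theorem permLength_mul_transp (w : SInf) {a b : ℕ+} (hab : a < b) (hw : w.1 a < w.1 b) :
    permLength (w * transp a b) = permLength w + (newInversions w.1 a b).ncard ∧
      (newInversions w.1 a b).Finite := by
  have h := inversions_mul_swap hab hw
  have hfin : (newInversions w.1 a b).Finite :=
    (finite_inversions (w * transp a b)).subset (by
      change _ ⊆ inversions (w.1 * Equiv.swap a b)
      rw [h]; exact Set.subset_union_right)
  refine ⟨?_, hfin⟩
  change (inversions (w.1 * Equiv.swap a b)).ncard = (inversions w.1).ncard + _
  rw [h, Set.ncard_union_eq (disjoint_transport_newInversions hab hw)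
    ((finite_inversions w).image _) hfin, (transportInversion_injOn hab hw).ncard_image]

theorem permLength_lt_mul_transp (w : SInf) {a b : ℕ+} (hab : a < b) (hw : w.1 a < w.1 b) :
    permLength w < permLength (w * transp a b) := by
  obtain ⟨h, hfin⟩ := permLength_mul_transp w hab hw
  have : 0 < (newInversions w.1 a b).ncard :=
    (Set.ncard_pos hfin).2 ⟨(a, b), Or.inl rfl⟩
  omega

theorem transp_mul_self (a b : ℕ+) : transp a b * transp a b = 1 :=
  Subtype.ext (Equiv.swap_mul_self a b)

/-- Multiplication by `(a b)` on the right raises the length by one exactly when `w a < w b` and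
no value at a position between `a` and `b` lies between `w a` and `w b`. -/
theorem permLength_mul_transp_eq_add_one_iff (w : SInf) {a b : ℕ+} (hab : a < b) :
    permLength (w * transp a b) = permLength w + 1 ↔
      w.1 a < w.1 b ∧ ∀ c, a < c → c < b → ¬ (w.1 a < w.1 c ∧ w.1 c < w.1 b) := by
  constructor
  · intro h
    have hw : w.1 a < w.1 b := by
      by_contra hn
      have hne : w.1 a ≠ w.1 b := fun e => hab.ne (w.1.injective e)
      have hlt : w.1 b < w.1 a := lt_of_le_of_ne (not_lt.1 hn) hne.symm
      have := permLength_lt_mul_transp (w * transp a b) hab (by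
        change w.1 (Equiv.swap a b a) < w.1 (Equiv.swap a b b)
        simpa using hlt)
      rw [mul_assoc, transp_mul_self, mul_one] at this
      omega
    refine ⟨hw, fun c hac hcb hc => ?_⟩
    obtain ⟨h1, hfin⟩ := permLength_mul_transp w hab hw
    have h2 : (newInversions w.1 a b).ncard = 1 := by omega
    obtain ⟨p, hp⟩ := Set.ncard_eq_one.1 h2
    have m1 : (a, b) ∈ newInversions w.1 a b := Or.inl rfl
    have m2 : (a, c) ∈ newInversions w.1 a b := Or.inr ⟨c, hac, hcb, hc.1, hc.2, Or.inl rfl⟩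
    rw [hp, Set.mem_singleton_iff] at m1 m2
    have := m1.trans m2.symm
    simp only [Prod.mk.injEq, true_and] at this
    exact hcb.ne' this
  · rintro ⟨hw, hb⟩
    have : newInversions w.1 a b = {(a, b)} := by
      ext p
      simp only [newInversions, Set.mem_ofPred_eq, Set.mem_singleton_iff]
      constructor
      · rintro (h | ⟨c, h1, h2, h3, h4, -⟩)
        · exact h
        · exact absurd ⟨h3, h4⟩ (hb c h1 h2)
      · exact Or.inl
    rw [(permLength_mul_transp w hab hw).1, this, Set.ncard_singleton]

/-! ### Local conditions for covers and the criterion for the k-Bruhat order -/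

/-- The local condition on `x = ζ⁻¹` under which `(α β) ζ` covers `ζ` in the universal order. -/
def UpStep (x : Equiv.Perm ℕ+) (α β : ℕ+) : Prop :=
  α < β ∧ x α ≤ α ∧ β ≤ x β ∧ ∀ γ, α < γ → γ < β → x α < x γ ∧ x γ < x β

/-- The local condition on `x = ζ⁻¹` under which `ζ` covers `(α β) ζ` in the universal order. -/
def DownStep (x : Equiv.Perm ℕ+) (α β : ℕ+) : Prop :=
  α < β ∧ x β ≤ α ∧ β ≤ x α ∧ ∀ γ, α < γ → γ < β → x β < x γ ∧ x γ < x α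

theorem mul_swap_eqs (x : Equiv.Perm ℕ+) (a b : ℕ+) :
    (x * Equiv.swap a b) a = x b ∧ (x * Equiv.swap a b) b = x a ∧
      ∀ c, c ≠ a → c ≠ b → (x * Equiv.swap a b) c = x c := by
  refine ⟨by simp, by simp, fun c h1 h2 => ?_⟩
  simp [Equiv.swap_apply_of_ne_of_ne h1 h2]

theorem downStep_mul_swap {x : Equiv.Perm ℕ+} {α β : ℕ+} :
    DownStep (x * Equiv.swap α β) α β ↔ UpStep x α β := by
  obtain ⟨h1, h2, h3⟩ := mul_swap_eqs x α β
  simp only [DownStep, UpStep, h1, h2]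
  refine and_congr_right fun _ => and_congr_right fun _ => and_congr_right fun _ => ?_
  refine forall_congr' fun γ => forall_congr' fun h => forall_congr' fun h' => ?_
  rw [h3 γ h.ne' h'.ne]

theorem upStep_mul_swap {x : Equiv.Perm ℕ+} {α β : ℕ+} :
    UpStep (x * Equiv.swap α β) α β ↔ DownStep x α β := by
  rw [← downStep_mul_swap, mul_assoc, Equiv.swap_mul_self, mul_one]

/-- The criterion for the `k`-Bruhat order in terms of values. -/
structure BruhatCrit (k : ℕ) (u w : Equiv.Perm ℕ+) : Prop where
  low : ∀ a : ℕ+, (a : ℕ) ≤ k → u a ≤ w a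
  high : ∀ b : ℕ+, k < (b : ℕ) → w b ≤ u b
  low_lt : ∀ a b : ℕ+, a < b → (b : ℕ) ≤ k → u a < u b → w a < w b
  high_lt : ∀ a b : ℕ+, a < b → k < (a : ℕ) → u a < u b → w a < w b

theorem BruhatCrit.refl (k : ℕ) (u : Equiv.Perm ℕ+) : BruhatCrit k u u :=
  ⟨fun _ _ => le_rfl, fun _ _ => le_rfl, fun _ _ _ _ h => h, fun _ _ _ _ h => h⟩

/-- A position c with value between w a and w b lies left of a if c ≤ k, and right of b otherwise.
Monotonicity on its side of k then compares u c with u a or u b, and the bounds `low` and `high`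
give the other comparison. -/
theorem BruhatCrit.step {k : ℕ} {u w : Equiv.Perm ℕ+} (h : BruhatCrit k u w) {a b : ℕ+}
    (ha : (a : ℕ) ≤ k) (hb : k < (b : ℕ)) (hab : w a < w b)
    (hbt : ∀ c, a < c → c < b → ¬ (w a < w c ∧ w c < w b)) :
    UpStep (u * w⁻¹) (w a) (w b) ∧ BruhatCrit k u (w * Equiv.swap a b) := by
  obtain ⟨e1, e2, e3⟩ := mul_swap_eqs w a b
  generalize w * Equiv.swap a b = w' at *
  have hlt : a < b := by rw [← PNat.coe_lt_coe]; omega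
  have inj : ∀ i j, w i = w j → i = j := fun i j h => w.injective h
  have uinj : ∀ i j, u i = u j → i = j := fun i j h => u.injective h
  obtain ⟨h1, h2, h3, h4⟩ := h
  have lt_nat : ∀ {i j : ℕ+}, i < j ↔ (i : ℕ) < j := PNat.coe_lt_coe _ _ |>.symm
  refine ⟨⟨hab, ?_, ?_, ?_⟩, ⟨?_, ?_, ?_, ?_⟩⟩
  · simpa using h1 a ha
  · simpa using h2 b hb
  · intro γ hγ hγ'
    obtain ⟨c, rfl⟩ := w.surjective γ
    rw [show (u * w⁻¹) (w a) = u a by simp, show (u * w⁻¹) (w b) = u b by simp,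
      show (u * w⁻¹) (w c) = u c by simp]
    have hb' := hbt c
    rcases le_or_gt (c : ℕ) k with hc | hc
    · have hcb : c < b := lt_nat.2 (by omega)
      have hca : c < a := by
        by_contra hn
        have : c ≠ a := by rintro rfl; exact lt_irrefl _ hγ
        exact hb' (lt_of_le_of_ne (not_lt.1 hn) this.symm) hcb ⟨hγ, hγ'⟩
      have := h3 c a hca ha
      have := h1 c hc
      have := h2 b hb
      have := uinj c a
      clear hbt h1 h2 h3 h4 lt_nat inj uinj e3
      grind +splitImp
    · have hca : a < c := lt_nat.2 (by omega)
      have hcb : b < c := by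
        by_contra hn
        have : c ≠ b := by rintro rfl; exact lt_irrefl _ hγ'
        exact hb' hca (lt_of_le_of_ne (not_lt.1 hn) this) ⟨hγ, hγ'⟩
      have := h4 b c hcb hb
      have := h2 c hc
      have := h1 a ha
      have := uinj c b
      clear hbt h1 h2 h3 h4 lt_nat inj uinj e3
      grind +splitImp
  · intro c hc
    have : c ≠ b := by rintro rfl; omega
    by_cases h : c = a
    · subst h; rw [e1]; exact (h1 c hc).trans hab.le
    · rw [e3 c h this]; exact h1 c hc
  · intro c hc
    have : c ≠ a := by rintro rfl; omega
    by_cases h : c = b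
    · subst h; rw [e2]; exact hab.le.trans (h2 c hc)
    · rw [e3 c this h]; exact h2 c hc
  · intro c d hcd hd hu
    have hdb : d ≠ b := by rintro rfl; omega
    have hdb' : d < b := lt_nat.2 (by omega)
    have := h3 c d hcd hd hu
    have := hbt d
    have := inj d b
    have := e3 c
    have := e3 d
    clear hbt h1 h2 h3 h4 lt_nat inj uinj e3
    grind +splitImp
  · intro c d hcd hc hu
    have hca : c ≠ a := by rintro rfl; omega
    have hca' : a < c := lt_nat.2 (by omega)
    have := h4 c d hcd hc hu
    have := hbt c
    have := inj c a
    have := e3 c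
    have := e3 d
    clear hbt h1 h2 h3 h4 lt_nat inj uinj e3
    grind +splitImp

/-- This is the converse passage: the up step and the criterion above it recover k-admissibility of
the positions, the cover, and the criterion below it. It lets a chain be descended without knowing
in advance that its elements lie above u. -/
theorem BruhatCrit.unstep {k : ℕ} {u w : Equiv.Perm ℕ+} {a b : ℕ+}
    (h : BruhatCrit k u (w * Equiv.swap a b)) (hup : UpStep (u * w⁻¹) (w a) (w b)) :
    (a : ℕ) ≤ k ∧ k < (b : ℕ) ∧ (∀ c, a < c → c < b → ¬ (w a < w c ∧ w c < w b)) ∧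
      BruhatCrit k u w := by
  obtain ⟨e1, e2, e3⟩ := mul_swap_eqs w a b
  generalize w * Equiv.swap a b = w' at *
  obtain ⟨hab, p1, p2, p3⟩ := hup
  have inj : ∀ i j, w i = w j → i = j := fun i j h => w.injective h
  rw [show (u * w⁻¹) (w b) = u b by simp] at p2
  rw [show (u * w⁻¹) (w a) = u a by simp] at p1
  replace p3 : ∀ c, w a < w c → w c < w b → u a < u c ∧ u c < u b := by
    intro c hc hc'
    simpa using p3 (w c) hc hc'
  obtain ⟨h1, h2, h3, h4⟩ := h
  have lt_nat : ∀ {i j : ℕ+}, i < j ↔ (i : ℕ) < j := PNat.coe_lt_coe _ _ |>.symm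
  -- At a position beyond k the criterion would give w b ≤ u a ≤ w a.
  have ha : (a : ℕ) ≤ k := by
    by_contra hn
    have := h2 a (not_le.1 hn)
    rw [e1] at this
    exact absurd (this.trans p1) (not_le.2 hab)
  have hb : k < (b : ℕ) := by
    by_contra hn
    have := h1 b (not_lt.1 hn)
    rw [e2] at this
    exact absurd (p2.trans this) (not_le.2 hab)
  refine ⟨ha, hb, ?_, ⟨?_, ?_, ?_, ?_⟩⟩
  -- By the up step, u c lies between u a and u b. Monotonicity on the side of k containing c then
  -- pushes w c above w b or below w a.
  · intro c hac hcb hc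
    have := p3 c hc.1 hc.2
    rcases le_or_gt (c : ℕ) k with hck | hck
    · have := h3 a c hac hck
      have := e3 c
      clear h1 h2 h3 h4 lt_nat inj p3 e3
      grind +splitImp
    · have := h4 c b hcb hck
      have := e3 c
      clear h1 h2 h3 h4 lt_nat inj p3 e3
      grind +splitImp
  · intro c hc
    have := h1 c hc
    have : c ≠ b := by rintro rfl; omega
    have := e3 c
    clear h1 h2 h3 h4 lt_nat inj p3 e3
    grind +splitImp
  · intro c hc
    have := h2 c hc
    have : c ≠ a := by rintro rfl; omega
    have := e3 c
    clear h1 h2 h3 h4 lt_nat inj p3 e3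
    grind +splitImp
  · intro c d hcd hd hu
    have hdb : d ≠ b := by rintro rfl; omega
    have hcb : c ≠ b := by rintro rfl; rw [lt_nat] at hcd; omega
    have := h3 c d hcd hd hu
    have := p3 c
    have := inj c a
    have := inj c b
    have := e3 c
    have := e3 d
    clear h1 h2 h3 h4 lt_nat inj p3 e3
    grind +splitImp
  · intro c d hcd hc hu
    have hca : c ≠ a := by rintro rfl; omega
    have hda : d ≠ a := by rintro rfl; rw [lt_nat] at hcd; omega
    have := h4 c d hcd hc hu
    have := p3 d
    have := inj d a
    have := inj d b
    have := e3 c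
    have := e3 d
    clear h1 h2 h3 h4 lt_nat inj p3 e3
    grind +splitImp

/-- Multiplying the lower end of a `k`-Bruhat relation by an atom. -/
theorem BruhatCrit.atom {k : ℕ} {u w : Equiv.Perm ℕ+} (h : BruhatCrit k u w) {i j : ℕ+}
    (hd : DownStep (w * u⁻¹) (u i) (u j)) :
    (i : ℕ) ≤ k ∧ k < (j : ℕ) ∧ (∀ c, i < c → c < j → ¬ (u i < u c ∧ u c < u j)) ∧
      BruhatCrit k (u * Equiv.swap i j) w := by
  obtain ⟨e1, e2, e3⟩ := mul_swap_eqs u i j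
  generalize u * Equiv.swap i j = u' at *
  obtain ⟨hab, p1, p2, p3⟩ := hd
  have inj : ∀ i j, u i = u j → i = j := fun i j h => u.injective h
  rw [show (w * u⁻¹) (u j) = w j by simp] at p1
  rw [show (w * u⁻¹) (u i) = w i by simp] at p2
  replace p3 : ∀ c, u i < u c → u c < u j → w j < w c ∧ w c < w i := by
    intro c hc hc'
    simpa using p3 (u c) hc hc'
  obtain ⟨h1, h2, h3, h4⟩ := h
  have lt_nat : ∀ {i j : ℕ+}, i < j ↔ (i : ℕ) < j := PNat.coe_lt_coe _ _ |>.symm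
  have hi : (i : ℕ) ≤ k := by
    by_contra hn
    have := h2 i (not_le.1 hn)
    exact absurd (p2.trans this) (not_le.2 hab)
  have hj : k < (j : ℕ) := by
    by_contra hn
    have := h1 j (not_lt.1 hn)
    exact absurd (this.trans p1) (not_le.2 hab)
  refine ⟨hi, hj, ?_, ⟨?_, ?_, ?_, ?_⟩⟩
  · intro c hic hcj hc
    have := p3 c hc.1 hc.2
    rcases le_or_gt (c : ℕ) k with hck | hck
    · have := h3 i c hic hck
      have := e3 c
      clear h1 h2 h3 h4 lt_nat inj p3 e3
      grind +splitImp
    · have := h4 c j hcj hck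
      have := e3 c
      clear h1 h2 h3 h4 lt_nat inj p3 e3
      grind +splitImp
  · intro c hc
    have := h1 c hc
    have : c ≠ j := by rintro rfl; omega
    have := e3 c
    clear h1 h2 h3 h4 lt_nat inj p3 e3
    grind +splitImp
  · intro c hc
    have := h2 c hc
    have : c ≠ i := by rintro rfl; omega
    have := e3 c
    clear h1 h2 h3 h4 lt_nat inj p3 e3
    grind +splitImp
  · intro c d hcd hd hu
    have hdb : d ≠ j := by rintro rfl; omega
    have hcb : c ≠ j := by rintro rfl; rw [lt_nat] at hcd; omega
    have := h3 c d hcd hd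
    have := p3 c
    have := inj c i
    have := inj c j
    have := e3 c
    have := e3 d
    clear h1 h2 h3 h4 lt_nat inj p3 e3
    grind +splitImp
  · intro c d hcd hc hu
    have hca : c ≠ i := by rintro rfl; omega
    have hda : d ≠ i := by rintro rfl; rw [lt_nat] at hcd; omega
    have := h4 c d hcd hc
    have := p3 d
    have := inj d i
    have := inj d j
    have := e3 c
    have := e3 d
    clear h1 h2 h3 h4 lt_nat inj p3 e3
    grind +splitImp

/-! ### Existence of down steps by counting -/

section Pigeonhole

variable {x : Equiv.Perm ℕ+}

theorem card_le_of_mapsTo (s t : Finset ℕ+) (h : ∀ i ∈ s, x i ∈ t) : s.card ≤ t.card :=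
  Finset.card_le_card_of_injOn x h x.injective.injOn

theorem exists_least {p : ℕ+ → Prop} (h : ∃ i, p i) : ∃ i, p i ∧ ∀ j, j < i → ¬ p j := by
  classical
  exact ⟨PNat.find h, PNat.find_spec h, fun j hj => PNat.find_min h hj⟩

theorem exists_greatest {p : ℕ+ → Prop} {N : ℕ+} (h : ∃ i, p i) (hN : ∀ i, p i → i ≤ N) :
    ∃ i, p i ∧ ∀ j, i < j → ¬ p j := by
  have hfin : {i | p i}.Finite := (Set.finite_Iic N).subset hN
  obtain ⟨m, hm⟩ := hfin.exists_maximal h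
  exact ⟨m, hm.1, fun j hj hp => absurd (hm.2 hp hj.le) (not_le.2 hj)⟩

theorem eq_one_of_forall_le (h : ∀ i, x i ≤ i) : x = 1 := by
  refine Equiv.ext fun i => ?_
  change x i = i
  induction i using PNat.strongInductionOn with
  | _ i ih =>
    rcases (h i).lt_or_eq with hi | hi
    · exact absurd (x.injective (ih _ hi)) hi.ne
    · exact hi

theorem exists_apply_lt (h : x ≠ 1) : ∃ i, x i < i := by
  by_contra hn
  push Not at hn
  apply h
  rw [← inv_eq_one]
  refine eq_one_of_forall_le fun i => ?_
  simpa using hn (x⁻¹ i)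

theorem exists_lt_apply (h : x ≠ 1) : ∃ i, i < x i := by
  by_contra hn
  push Not at hn
  exact h (eq_one_of_forall_le hn)

/-- Positions in [x β, β) do not go down. If none reached β, then x would map them together with β
into [x β, β), which is one element too small. The greatest position that reaches β leaves nothing
in between that does. -/
theorem exists_left_partner {β : ℕ+} (hβ : x β < β) (hlow : ∀ i, i < β → i ≤ x i) :
    ∃ α, α < β ∧ x β ≤ α ∧ β ≤ x α ∧ ∀ i, α < i → i < β → x i < β := by
  have hex : ∃ i, x β ≤ i ∧ i < β ∧ β ≤ x i := by
    by_contra hn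
    push Not at hn
    have h : (insert β (Finset.Ico (x β) β)).card ≤ (Finset.Ico (x β) β).card := by
      apply card_le_of_mapsTo (x := x)
      intro i hi
      simp only [Finset.mem_insert, Finset.mem_Ico] at hi ⊢
      rcases hi with rfl | ⟨h1, h2⟩
      · exact ⟨le_rfl, hβ⟩
      · exact ⟨h1.trans (hlow i h2), hn i h1 h2⟩
    rw [Finset.card_insert_of_notMem (by simp)] at h
    omega
  obtain ⟨α, ⟨h1, h2, h3⟩, hmax⟩ := exists_greatest hex (fun i hi => hi.2.1.le)
  refine ⟨α, h2, h1, h3, fun i hi hi' => ?_⟩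
  by_contra hc
  exact hmax i hi ⟨h1.trans hi.le, hi', not_lt.1 hc⟩

theorem exists_right_partner {α : ℕ+} (hα : α < x α) (hhigh : ∀ i, α < i → x i ≤ i) :
    ∃ β, α < β ∧ x β ≤ α ∧ β ≤ x α ∧ ∀ i, α < i → i < β → α < x i := by
  have hex : ∃ i, α < i ∧ i ≤ x α ∧ x i ≤ α := by
    by_contra hn
    push Not at hn
    have h : (insert α (Finset.Ioc α (x α))).card ≤ (Finset.Ioc α (x α)).card := by
      apply card_le_of_mapsTo (x := x)
      intro i hi
      simp only [Finset.mem_insert, Finset.mem_Ioc] at hi ⊢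
      rcases hi with rfl | ⟨h1, h2⟩
      · exact ⟨hα, le_rfl⟩
      · exact ⟨hn i h1 h2, (hhigh i h1).trans h2⟩
    rw [Finset.card_insert_of_notMem (by simp)] at h
    omega
  obtain ⟨β, ⟨h1, h2, h3⟩, hmin⟩ := exists_least hex
  refine ⟨β, h1, h3, h2, fun i hi hi' => ?_⟩
  by_contra hc
  exact hmin i hi' ⟨hi, hi'.le.trans h2, not_lt.1 hc⟩

/-- Since i ≤ x i to the left of β, the lower half of the betweenness is automatic. -/
theorem downStep_of_left {α β : ℕ+} (hαβ : α < β) (h1 : x β ≤ α) (h2 : β ≤ x α)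
    (hlow : ∀ i, i < β → i ≤ x i) (h : ∀ i, α < i → i < β → x i < β) : DownStep x α β :=
  ⟨hαβ, h1, h2, fun i hi hi' =>
    ⟨h1.trans_lt (hi.trans_le (hlow i hi')), (h i hi hi').trans_le h2⟩⟩

theorem downStep_of_right {α β : ℕ+} (hαβ : α < β) (h1 : x β ≤ α) (h2 : β ≤ x α)
    (hhigh : ∀ i, α < i → x i ≤ i) (h : ∀ i, α < i → i < β → α < x i) : DownStep x α β :=
  ⟨hαβ, h1, h2, fun i hi hi' =>
    ⟨h1.trans_lt (h i hi hi'), ((hhigh i hi).trans_lt hi').trans_le h2⟩⟩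

/-- The first position with `x β < β` ends a down step. -/
theorem exists_leftmost_downStep (hx : x ≠ 1) : ∃ α β, DownStep x α β ∧ x β < β ∧
    (∀ i, i < β → i ≤ x i) ∧ ∀ i, α < i → i < β → x i < β := by
  obtain ⟨β, h1, h2⟩ := exists_least (exists_apply_lt hx)
  have hlow : ∀ i, i < β → i ≤ x i := fun i hi => not_lt.1 (h2 i hi)
  obtain ⟨α, a1, a2, a3, a4⟩ := exists_left_partner h1 hlow
  exact ⟨α, β, downStep_of_left a1 a2 a3 hlow a4, h1, hlow, a4⟩

/-- The last position with `α < x α` begins a down step. -/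
theorem exists_rightmost_downStep (hx : x ≠ 1) {N : ℕ+} (hN : ∀ i, N < i → x i = i) :
    ∃ α β, DownStep x α β ∧ α < x α ∧
    (∀ i, α < i → x i ≤ i) ∧ ∀ i, α < i → i < β → α < x i := by
  obtain ⟨α, h1, h2⟩ := exists_greatest (exists_lt_apply hx) (N := N) (by
    intro i hi
    by_contra h
    rw [hN i (not_le.1 h)] at hi
    exact lt_irrefl _ hi)
  have hhigh : ∀ i, α < i → x i ≤ i := fun i hi => not_lt.1 (h2 i hi)
  obtain ⟨β, a1, a2, a3, a4⟩ := exists_right_partner h1 hhigh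
  exact ⟨α, β, downStep_of_right a1 a2 a3 hhigh a4, h1, hhigh, a4⟩

/-- This finds the index α that relation 1 requires when two down steps share their left end.
Without it, x would send γ, δ and all of [x δ, γ) except β into [x δ, γ), one element too many. -/
theorem exists_left_of_shared_left {β γ δ : ℕ+} (hlow : ∀ i, i < γ → i ≤ x i)
    (hmid : ∀ i, β < i → i < γ → x i < γ) (h1 : DownStep x β γ) (h2 : DownStep x β δ)
    (hγδ : γ < δ) : ∃ α, α < β ∧ x δ ≤ α ∧ γ ≤ x α ∧ ∀ i, α < i → i < β → x i < γ := by
  have hδγ := (h2.2.2.2 γ h1.1 hγδ).1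
  have hex : ∃ i, x δ ≤ i ∧ i < β ∧ γ ≤ x i := by
    by_contra hn
    push Not at hn
    have hβ : β ∈ Finset.Ico (x δ) γ := Finset.mem_Ico.2 ⟨h2.2.1, h1.1⟩
    have h : (insert δ (insert γ ((Finset.Ico (x δ) γ).erase β))).card ≤
        (Finset.Ico (x δ) γ).card := by
      apply card_le_of_mapsTo (x := x)
      intro i hi
      simp only [Finset.mem_insert, Finset.mem_Ico, Finset.mem_erase] at hi ⊢
      rcases hi with rfl | rfl | ⟨h0, h3, h4⟩
      · exact ⟨le_rfl, hδγ.trans_le (h1.2.1.trans h1.1.le)⟩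
      · exact ⟨hδγ.le, h1.2.1.trans_lt h1.1⟩
      · refine ⟨h3.trans (hlow i h4), ?_⟩
        rcases lt_or_gt_of_ne h0 with h5 | h5
        · exact hn i h3 h5
        · exact hmid i h5 h4
    rw [Finset.card_insert_of_notMem, Finset.card_insert_of_notMem,
      Finset.card_erase_of_mem hβ] at h
    · have := Finset.card_pos.2 ⟨β, hβ⟩
      omega
    · simp
    · simp [hγδ.ne', hγδ.le]
  obtain ⟨α, ⟨h3, h4, h5⟩, hmax⟩ := exists_greatest hex (fun i hi => hi.2.1.le)
  refine ⟨α, h4, h3, h5, fun i hi hi' => ?_⟩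
  by_contra hc
  exact hmax i hi ⟨h3.trans hi.le, hi', not_lt.1 hc⟩

/-- This finds the index δ for relation 2 by the mirror count: otherwise α, β and all of (β, x α]
except γ would be sent into (β, x α]. -/
theorem exists_right_of_shared_right {α β γ : ℕ+} (hlow : ∀ i, i < γ → i ≤ x i)
    (hhigh : ∀ i, γ < i → x i ≤ i) (h1 : DownStep x α γ) (h2 : DownStep x β γ)
    (hαβ : α < β) : ∃ δ, γ < δ ∧ δ ≤ x α ∧ x δ ≤ β ∧ ∀ i, γ < i → i < δ → β < x i := by
  have hβγ := h2.1
  have hb := (h1.2.2.2 β hαβ hβγ).2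
  have hex : ∃ i, γ < i ∧ i ≤ x α ∧ x i ≤ β := by
    by_contra hn
    push Not at hn
    have hγ : γ ∈ Finset.Ioc β (x α) := Finset.mem_Ioc.2 ⟨hβγ, h1.2.2.1⟩
    have h : (insert α (insert β ((Finset.Ioc β (x α)).erase γ))).card ≤
        (Finset.Ioc β (x α)).card := by
      apply card_le_of_mapsTo (x := x)
      intro i hi
      simp only [Finset.mem_insert, Finset.mem_Ioc, Finset.mem_erase] at hi ⊢
      rcases hi with rfl | rfl | ⟨h0, h3, h4⟩
      · exact ⟨hβγ.trans_le h1.2.2.1, le_rfl⟩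
      · exact ⟨hβγ.trans_le h2.2.2.1, hb.le⟩
      · rcases lt_or_gt_of_ne h0 with h5 | h5
        · exact ⟨h3.trans_le (hlow i h5), (h1.2.2.2 i (hαβ.trans h3) h5).2.le⟩
        · exact ⟨hn i h5 h4, (hhigh i h5).trans h4⟩
    rw [Finset.card_insert_of_notMem, Finset.card_insert_of_notMem,
      Finset.card_erase_of_mem hγ] at h
    · have := Finset.card_pos.2 ⟨γ, hγ⟩
      omega
    · simp
    · simp [hαβ.ne, hαβ.le]
  obtain ⟨δ, ⟨h3, h4, h5⟩, hmin⟩ := exists_least hex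
  refine ⟨δ, h3, h4, h5, fun i hi hi' => ?_⟩
  by_contra hc
  exact hmin i hi' ⟨hi, hi'.le.trans h4, not_lt.1 hc⟩

end Pigeonhole

/-! ### A base permutation for every ζ -/

/-- Permutations supported in `[1, N]` list these numbers in any prescribed linear order. -/
theorem exists_sorting_perm {α : Type*} [LinearOrder α] (f : ℕ+ → α) (N : ℕ+) :
    ∃ u : SInf, (∀ i, N < i → u.1 i = i) ∧ (∀ i, i ≤ N → u.1 i ≤ N) ∧
      ∀ i j, i ≤ j → j ≤ N → f (u.1 i) ≤ f (u.1 j) := by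
  let e : Fin (Finset.Icc 1 N).card ≃o (Finset.Icc 1 N) := (Finset.Icc 1 N).orderIsoOfFin rfl
  let σ := Tuple.sort fun i => f (e i)
  have hσ : Monotone ((fun i => f (e i)) ∘ σ) := Tuple.monotone_sort _
  let u : Equiv.Perm ℕ+ := σ.extendDomain (p := (· ∈ Finset.Icc 1 N)) e.toEquiv
  have hout : ∀ i, N < i → u i = i := fun i hi =>
    Equiv.Perm.extendDomain_apply_not_subtype _ _ (by simpa using hi)
  have hin : ∀ i (hi : i ≤ N), u i = e (σ (e.symm ⟨i, by simpa using hi⟩)) := fun i hi => by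
    have := Equiv.Perm.extendDomain_apply_image σ (p := (· ∈ Finset.Icc 1 N)) e.toEquiv
      (e.symm ⟨i, by simpa using hi⟩)
    simpa using this
  refine ⟨⟨u, (Set.finite_Iic N).subset fun i hi => ?_⟩, hout, fun i hi => ?_,
    fun i j hij hj => ?_⟩
  · by_contra h
    exact hi (hout i (not_le.1 h))
  · change u i ≤ N
    rw [hin i hi]
    exact (Finset.mem_Icc.1 (e _).2).2
  · change f (u i) ≤ f (u j)
    rw [hin i (hij.trans hj), hin j hj]
    exact hσ (e.symm.monotone hij)

/-- A permutation listing the positions with `i < ζ i`, then the others, each in decreasing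
order, witnesses the criterion for `ζ`. -/
theorem exists_bruhatCrit (ζ : SInf) :
    ∃ (u : SInf) (k : ℕ), BruhatCrit k u.1 (ζ * u).1 := by
  obtain ⟨N, hN⟩ := exists_bound ζ
  obtain ⟨u, hout, hin, hmono⟩ := exists_sorting_perm
    -- As `false` precedes `true`, the numbers raised by ζ come first; the dual order lists each of
    -- the two groups decreasingly.
    (fun i => toLex (decide (ζ.1 i ≤ i), OrderDual.toDual i)) N
  have hle : ∀ i j, i ≤ j → j ≤ N → u.1 j < ζ.1 (u.1 j) → u.1 i < ζ.1 (u.1 i) := by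
    intro i j hij hj h
    have := hmono i j hij hj
    rw [Prod.Lex.toLex_le_toLex] at this
    by_contra hn
    simp only [not_le.2 h, not_lt.1 hn, decide_true, decide_false] at this
    rcases this with h1 | h1
    · exact absurd h1 (by decide)
    · exact absurd h1.1 (by decide)
  have hanti : ∀ i j, i < j → j ≤ N →
      ((u.1 i < ζ.1 (u.1 i)) ↔ (u.1 j < ζ.1 (u.1 j))) → u.1 j < u.1 i := by
    intro i j hij hj h
    have := hmono i j hij.le hj
    rw [Prod.Lex.toLex_le_toLex] at this
    have hne : u.1 i ≠ u.1 j := fun e => hij.ne (u.1.injective e)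
    have hd : decide (ζ.1 (u.1 i) ≤ u.1 i) = decide (ζ.1 (u.1 j) ≤ u.1 j) := by
      rw [decide_eq_decide, ← not_lt, ← not_lt, h]
    rcases this with h1 | h1
    · exact absurd h1 (by simp [hd])
    · exact lt_of_le_of_ne h1.2 hne.symm
  have hk : ∃ k : ℕ, k ≤ N ∧ ∀ i : ℕ+, i ≤ N → ((i : ℕ) ≤ k ↔ u.1 i < ζ.1 (u.1 i)) := by
    by_cases hall : ∃ i, i ≤ N ∧ ζ.1 (u.1 i) ≤ u.1 i
    · obtain ⟨m, ⟨h1, h2⟩, h3⟩ := exists_least hall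
      have hm := PNat.coe_le_coe m N |>.2 h1
      have := m.pos
      -- The position m is the first to hold a number that ζ does not raise, so the raised ones
      -- occupy the positions up to m - 1.
      refine ⟨(m : ℕ) - 1, by omega, fun i hi => ⟨fun h => ?_, fun h => ?_⟩⟩
      · have him : i < m := (PNat.coe_lt_coe _ _).1 (by omega)
        by_contra hn
        exact h3 i him ⟨hi, not_lt.1 hn⟩
      · by_contra hn
        have hmi : m ≤ i := (PNat.coe_le_coe _ _).1 (by omega)
        exact absurd (hle m i hmi hi h) (not_lt.2 h2)
    · push Not at hall
      exact ⟨N, le_rfl, fun i hi => ⟨fun _ => hall i hi, fun _ => (PNat.coe_le_coe _ _).2 hi⟩⟩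
  obtain ⟨k, hkN, hk⟩ := hk
  have hleN : ∀ {i : ℕ+}, (i : ℕ) ≤ k → i ≤ N := fun h =>
    (PNat.coe_le_coe _ _).1 (h.trans hkN)
  have hfix : ∀ i, N < i → ζ.1 (u.1 i) = i := fun i hi => by rw [hout i hi, hN i hi]
  refine ⟨u, k, ⟨fun a ha => ?_, fun b hb => ?_, fun a b hab hb h => ?_, fun a b hab ha h => ?_⟩⟩
  · exact ((hk a (hleN ha)).1 ha).le
  · change ζ.1 (u.1 b) ≤ u.1 b
    rcases le_or_gt b N with hbN | hbN
    · exact not_lt.1 fun h => absurd ((hk b hbN).2 h) (by omega)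
    · rw [hfix b hbN, hout b hbN]
  · have ha : (a : ℕ) ≤ k := ((PNat.coe_lt_coe _ _).2 hab).le.trans hb
    -- Inside a group u is decreasing, so the monotonicity condition is vacuous.
    exact absurd (hanti a b hab (hleN hb)
      (iff_of_true ((hk a (hleN ha)).1 ha) ((hk b (hleN hb)).1 hb))) (lt_asymm h)
  · change ζ.1 (u.1 a) < ζ.1 (u.1 b)
    have hb : k < (b : ℕ) := ha.trans ((PNat.coe_lt_coe _ _).2 hab)
    rcases le_or_gt b N with hbN | hbN
    · exact absurd (hanti a b hab hbN (iff_of_false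
        (fun h => absurd ((hk a (hab.le.trans hbN)).2 h) (by omega))
        (fun h => absurd ((hk b hbN).2 h) (by omega)))) (lt_asymm h)
    · rw [hfix b hbN]
      rcases le_or_gt a N with haN | haN
      · by_contra hn
        -- A value of ζ beyond N is a fixed point of ζ, hence equals its own preimage u a, which is
        -- at most N.
        have hlt : N < ζ.1 (u.1 a) := hbN.trans_le (not_lt.1 hn)
        have := ζ.1.injective (hN _ hlt)
        exact absurd (hin a haN) (not_le.2 (this ▸ hlt))
      · rw [hfix a haN]
        exact hab

/-! ### Labelled chains in the two orders -/

/-- The word `[g_n, …, g_1]` labels a saturated chain from `η` up to `ζ` in the universal order. -/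
def IsPath (η : SInf) : List GenIdx → SInf → Prop
  | [], ζ => ζ = η
  | g :: w, ζ => ∃ ξ, IsPath η w ξ ∧ UpStep ξ⁻¹.1 g.1.1 g.1.2 ∧ ζ = transp g.1.1 g.1.2 * ξ

/-- A cover of the `k`-Bruhat order that multiplies by the transposition `g` of values. -/
def IsKStep (k : ℕ) (w : SInf) (g : GenIdx) (w' : SInf) : Prop :=
  ((w⁻¹.1 g.1.1 : ℕ+) : ℕ) ≤ k ∧ k < ((w⁻¹.1 g.1.2 : ℕ+) : ℕ) ∧
    (∀ c, w⁻¹.1 g.1.1 < c → c < w⁻¹.1 g.1.2 → ¬ (g.1.1 < w.1 c ∧ w.1 c < g.1.2)) ∧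
    w' = transp g.1.1 g.1.2 * w

/-- The word `[g_n, …, g_1]` labels a saturated chain from `u` up to `w` in the `k`-Bruhat
order. -/
def IsKPath (k : ℕ) (u : SInf) : List GenIdx → SInf → Prop
  | [], w => w = u
  | g :: l, w => ∃ v, IsKPath k u l v ∧ IsKStep k v g w

theorem SInf_mul_transp (w : SInf) (a b : ℕ+) : w * transp a b = transp (w.1 a) (w.1 b) * w :=
  Subtype.ext (Equiv.mul_swap_eq_swap_mul _ _ _)

theorem transp_mul_SInf (w : SInf) (a b : ℕ+) :
    transp a b * w = w * transp (w⁻¹.1 a) (w⁻¹.1 b) := by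
  rw [SInf_mul_transp]
  congr 2 <;> exact (Equiv.apply_symm_apply w.1 _).symm

theorem transp_inv (a b : ℕ+) : (transp a b)⁻¹ = transp a b :=
  inv_eq_of_mul_eq_one_right (transp_mul_self a b)

theorem inv_val_apply (w : SInf) (a : ℕ+) : w⁻¹.1 (w.1 a) = a := Equiv.symm_apply_apply w.1 a

theorem val_inv_apply (w : SInf) (a : ℕ+) : w.1 (w⁻¹.1 a) = a := Equiv.apply_symm_apply w.1 a

theorem IsKStep.permLength {k : ℕ} {w w' : SInf} {g : GenIdx} (h : IsKStep k w g w') :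
    permLength w' = permLength w + 1 := by
  obtain ⟨h1, h2, h3, rfl⟩ := h
  rw [transp_mul_SInf, permLength_mul_transp_eq_add_one_iff]
  · simp only [val_inv_apply]
    exact ⟨g.2, h3⟩
  · rw [← PNat.coe_lt_coe]; omega

theorem kCover_iff {k : ℕ} {w w' : SInf} : KCover k w w' ↔ ∃ g, IsKStep k w g w' := by
  constructor
  · rintro ⟨a, b, ha, hb, rfl, hl⟩
    have hab : a < b := by rw [← PNat.coe_lt_coe]; omega
    rw [permLength_mul_transp_eq_add_one_iff w hab] at hl
    refine ⟨genIdx hl.1, ?_⟩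
    simp only [IsKStep, genIdx, inv_val_apply]
    exact ⟨ha, hb, hl.2, SInf_mul_transp w a b⟩
  · rintro ⟨g, h⟩
    refine ⟨_, _, h.1, h.2.1, ?_, h.permLength⟩
    rw [← transp_mul_SInf]
    exact h.2.2.2

theorem kle_iff_exists_isKPath {k : ℕ} {u w : SInf} : KLE k u w ↔ ∃ l, IsKPath k u l w := by
  constructor
  · intro h
    induction h with
    | refl => exact ⟨[], rfl⟩
    | tail _ h ih =>
      obtain ⟨l, hl⟩ := ih
      obtain ⟨g, hg⟩ := kCover_iff.1 h
      exact ⟨g :: l, _, hl, hg⟩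
  · rintro ⟨l, hl⟩
    induction l generalizing w with
    | nil => exact hl ▸ Relation.ReflTransGen.refl
    | cons g l ih =>
      obtain ⟨v, h1, h2⟩ := hl
      exact (ih h1).tail (kCover_iff.2 ⟨g, h2⟩)

theorem IsKPath.permLength {k : ℕ} {u w : SInf} {l : List GenIdx} (h : IsKPath k u l w) :
    permLength w = permLength u + l.length := by
  induction l generalizing w with
  | nil => rw [show w = u from h]; rfl
  | cons g l ih =>
    obtain ⟨v, h1, h2⟩ := h
    rw [h2.permLength, ih h1, List.length_cons]
    omega

theorem IsKStep.bruhatCrit {k : ℕ} {u w w' : SInf} {g : GenIdx} (h : BruhatCrit k u.1 w.1)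
    (hs : IsKStep k w g w') : UpStep (u * w⁻¹).1 g.1.1 g.1.2 ∧ BruhatCrit k u.1 w'.1 := by
  obtain ⟨h1, h2, h3, rfl⟩ := hs
  have := h.step h1 h2 (by simpa only [val_inv_apply] using g.2)
    (by simpa only [val_inv_apply] using h3)
  simp only [val_inv_apply] at this
  rw [transp_mul_SInf]
  exact this

theorem isKStep_of_upStep {k : ℕ} {u w : SInf} {g : GenIdx}
    (h : BruhatCrit k u.1 (transp g.1.1 g.1.2 * w).1) (hs : UpStep (u * w⁻¹).1 g.1.1 g.1.2) :
    BruhatCrit k u.1 w.1 ∧ IsKStep k w g (transp g.1.1 g.1.2 * w) := by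
  rw [transp_mul_SInf] at h
  obtain ⟨h1, h2, h3, h4⟩ := h.unstep (by rw [val_inv_apply, val_inv_apply]; exact hs)
  simp only [val_inv_apply] at h3
  exact ⟨h4, h1, h2, h3, rfl⟩

/-- Chains in the universal order and in the `k`-Bruhat order have the same labels. -/
theorem isPath_and_crit_iff {k : ℕ} {u η ζ : SInf} {w : List GenIdx} :
    IsPath η w ζ ∧ BruhatCrit k u.1 (ζ * u).1 ↔
      BruhatCrit k u.1 (η * u).1 ∧ IsKPath k (η * u) w (ζ * u) := by
  induction w generalizing ζ with
  | nil =>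
    constructor
    · rintro ⟨h, h'⟩
      cases (show ζ = η from h)
      exact ⟨h', rfl⟩
    · rintro ⟨h, h'⟩
      cases mul_right_cancel (show ζ * u = η * u from h')
      exact ⟨rfl, h⟩
  | cons g w ih =>
    have e : ∀ ξ : SInf, u * (ξ * u)⁻¹ = ξ⁻¹ := fun ξ => by group
    constructor
    -- The criterion is known at the top and is carried down by each up step; in the other direction
    -- it is carried up from the bottom.
    · rintro ⟨⟨ξ, h1, h2, rfl⟩, h3⟩
      rw [mul_assoc] at h3 ⊢
      obtain ⟨h4, h5⟩ := isKStep_of_upStep h3 (by rwa [e])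
      obtain ⟨h6, h7⟩ := ih.1 ⟨h1, h4⟩
      exact ⟨h6, _, h7, h5⟩
    · rintro ⟨h1, v, h2, h3⟩
      obtain ⟨ξ, rfl⟩ : ∃ ξ, v = ξ * u := ⟨v * u⁻¹, by group⟩
      obtain ⟨h4, h5⟩ := ih.2 ⟨h1, h2⟩
      obtain ⟨h6, h7⟩ := h3.bruhatCrit h5
      rw [e] at h6
      refine ⟨⟨ξ, h4, h6, ?_⟩, h7⟩
      have := h3.2.2.2
      rw [← mul_assoc] at this
      exact mul_right_cancel this

theorem IsPath.append {η ξ ζ : SInf} {v w : List GenIdx} (hv : IsPath η v ξ)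
    (hw : IsPath ξ w ζ) : IsPath η (w ++ v) ζ := by
  induction w generalizing ζ with
  | nil => cases (show ζ = ξ from hw); exact hv
  | cons g w ih =>
    obtain ⟨σ, h1, h2⟩ := hw
    exact ⟨σ, ih h1, h2⟩

theorem DownStep.isPath {ζ : SInf} {α β : ℕ+} (h : DownStep ζ⁻¹.1 α β) :
    UpStep (transp α β * ζ)⁻¹.1 α β := by
  rw [mul_inv_rev, transp_inv]
  exact upStep_mul_swap.2 h

/-- If w ≠ u, then u w⁻¹ is not the identity and has a down step. Removing its transposition from w
gives a cover whose lower end still satisfies the criterion and has smaller length. -/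
theorem isKPath_of_crit {k : ℕ} {u w : SInf} (h : BruhatCrit k u.1 w.1) :
    ∃ l, IsKPath k u l w := by
  induction hn : permLength w using Nat.strong_induction_on generalizing w with
  | _ n ih =>
    by_cases hw : w = u
    · exact ⟨[], hw⟩
    · obtain ⟨α, β, hd, -⟩ := exists_leftmost_downStep (x := (u * w⁻¹).1) (by
        intro h1
        have : u * w⁻¹ = 1 := Subtype.ext h1
        exact hw (mul_inv_eq_one.1 this).symm)
      let v := transp α β * w
      have hwv : transp α β * v = w := by rw [← mul_assoc, transp_mul_self, one_mul]
      have hup : UpStep (u * v⁻¹).1 α β := by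
        rw [mul_inv_rev, transp_inv, ← mul_assoc]
        exact upStep_mul_swap.2 hd
      obtain ⟨h1, h2⟩ := isKStep_of_upStep (g := genIdx hd.1) (u := u) (w := v) (k := k)
        (by simp only [genIdx]; rwa [hwv]) hup
      simp only [genIdx, hwv] at h2
      have hl := h2.permLength
      obtain ⟨l, hl'⟩ := ih (permLength v) (by omega) h1 rfl
      exact ⟨_ :: l, v, hl', h2⟩

theorem kle_iff_crit {k : ℕ} {u w : SInf} : KLE k u w ↔ BruhatCrit k u.1 w.1 := by
  rw [kle_iff_exists_isKPath]
  refine ⟨fun ⟨l, hl⟩ => ?_, isKPath_of_crit⟩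
  -- With η = 1 the criterion at the bottom is reflexivity.
  have := (isPath_and_crit_iff (k := k) (u := u) (η := 1) (ζ := w * u⁻¹) (w := l)).2
    ⟨by rw [one_mul]; exact .refl _ _, by simpa using hl⟩
  simpa using this.2

theorem exists_kle (ζ : SInf) : ∃ (u : SInf) (k : ℕ), KLE k u (ζ * u) := by
  obtain ⟨u, k, h⟩ := exists_bruhatCrit ζ
  exact ⟨u, k, kle_iff_crit.2 h⟩

/-! ### The universal order and its rank -/

/-- Chains in an interval `[u, ζ u]` of the `k`-Bruhat order. -/
theorem isPath_iff_isKPath {k : ℕ} {u η ζ : SInf} {w : List GenIdx} (h : KLE k u (ζ * u)) :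
    IsPath η w ζ ↔ KLE k u (η * u) ∧ IsKPath k (η * u) w (ζ * u) := by
  rw [kle_iff_crit] at h ⊢
  rw [← isPath_and_crit_iff]
  exact (and_iff_left h).symm

theorem exists_isPath_iff {k : ℕ} {u η ζ : SInf} (h : KLE k u (ζ * u)) :
    (∃ w, IsPath η w ζ) ↔ KLE k u (η * u) ∧ KLE k (η * u) (ζ * u) := by
  simp only [isPath_iff_isKPath h, exists_and_left, kle_iff_exists_isKPath (u := η * u)]

theorem uble_iff {η ζ : SInf} : UBLE η ζ ↔ ∃ w, IsPath η w ζ := by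
  constructor
  · rintro ⟨u, k, h1, h2⟩
    exact (exists_isPath_iff (Relation.ReflTransGen.trans h1 h2)).2 ⟨h1, h2⟩
  · intro h
    obtain ⟨u, k, hk⟩ := exists_kle ζ
    exact ⟨u, k, (exists_isPath_iff hk).1 h⟩

/-- The definition of ≼ asks for some base. Since up steps do not see the base, any one that works
for ζ decides η ≼ ζ for all η. -/
theorem uble_iff_kle {k : ℕ} {u η ζ : SInf} (h : KLE k u (ζ * u)) :
    UBLE η ζ ↔ KLE k u (η * u) ∧ KLE k (η * u) (ζ * u) := by
  rw [uble_iff, exists_isPath_iff h]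

theorem one_uble (ζ : SInf) : UBLE 1 ζ := by
  obtain ⟨u, k, hk⟩ := exists_kle ζ
  exact ⟨u, k, by rw [one_mul]; exact .refl, by rwa [one_mul]⟩

theorem exists_isPath_one (ζ : SInf) : ∃ w, IsPath 1 w ζ := uble_iff.1 (one_uble ζ)

theorem permLength_of_isPath {k : ℕ} {u ζ : SInf} {w : List GenIdx} (h : KLE k u (ζ * u))
    (hw : IsPath 1 w ζ) : permLength (ζ * u) = permLength u + w.length := by
  have := ((isPath_iff_isKPath h).1 hw).2.permLength
  rwa [one_mul] at this

/-- Any base turns the word into a k-Bruhat chain of the same length, so the set whose infimum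
defines `rankU` has exactly one element. -/
theorem rankU_eq {ζ : SInf} {w : List GenIdx} (hw : IsPath 1 w ζ) : rankU ζ = w.length := by
  have : {n | ∃ (u : SInf) (k : ℕ), KLE k u (ζ * u) ∧
      permLength (ζ * u) = permLength u + n} = {w.length} := by
    ext n
    simp only [Set.mem_ofPred_eq, Set.mem_singleton_iff]
    constructor
    · rintro ⟨u, k, h1, h2⟩
      have := permLength_of_isPath h1 hw
      omega
    · rintro rfl
      obtain ⟨u, k, hk⟩ := exists_kle ζ
      exact ⟨u, k, hk, permLength_of_isPath hk hw⟩
  rw [rankU, this, csInf_singleton]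

theorem permLength_eq_add_rankU {k : ℕ} {u ζ : SInf} (h : KLE k u (ζ * u)) :
    permLength (ζ * u) = permLength u + rankU ζ := by
  obtain ⟨w, hw⟩ := exists_isPath_one ζ
  rw [rankU_eq hw, permLength_of_isPath h hw]

theorem IsPath.rankU_eq {η ζ : SInf} {w : List GenIdx} (hw : IsPath η w ζ) :
    rankU ζ = rankU η + w.length := by
  obtain ⟨v, hv⟩ := exists_isPath_one η
  rw [_root_.rankU_eq (hv.append hw), _root_.rankU_eq hv, List.length_append, add_comm]

theorem uble_refl (η : SInf) : UBLE η η := uble_iff.2 ⟨[], rfl⟩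

theorem uble_trans {η ζ ξ : SInf} (h1 : UBLE η ζ) (h2 : UBLE ζ ξ) : UBLE η ξ := by
  obtain ⟨v, hv⟩ := uble_iff.1 h1
  obtain ⟨w, hw⟩ := uble_iff.1 h2
  exact uble_iff.2 ⟨_, hv.append hw⟩

theorem uble_eq_of_rankU_le {η ζ : SInf} (h : UBLE η ζ) (hr : rankU ζ ≤ rankU η) : η = ζ := by
  obtain ⟨w, hw⟩ := uble_iff.1 h
  have := hw.rankU_eq
  have : w = [] := List.eq_nil_of_length_eq_zero (by omega)
  subst this
  exact (show ζ = η from hw).symm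

theorem uble_rankU_le {η ζ : SInf} (h : UBLE η ζ) : rankU η ≤ rankU ζ := by
  obtain ⟨w, hw⟩ := uble_iff.1 h
  have := hw.rankU_eq
  omega

theorem uble_antisymm {η ζ : SInf} (h1 : UBLE η ζ) (h2 : UBLE ζ η) : η = ζ :=
  uble_eq_of_rankU_le h1 (uble_rankU_le h2)

theorem rankU_one : rankU 1 = 0 := rankU_eq (w := []) rfl

theorem UpStep.isPath {ζ : SInf} {g : GenIdx} (h : UpStep ζ⁻¹.1 g.1.1 g.1.2) :
    IsPath ζ [g] (transp g.1.1 g.1.2 * ζ) := ⟨ζ, rfl, h, rfl⟩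

theorem genIdx_eq_of_transp_eq {g h : GenIdx} (e : transp g.1.1 g.1.2 = transp h.1.1 h.1.2) :
    g = h := by
  obtain ⟨⟨a, b⟩, hab⟩ := g
  obtain ⟨⟨c, d⟩, hcd⟩ := h
  simp only at hab hcd e
  have e' : Equiv.swap a b = Equiv.swap c d := congrArg Subtype.val e
  have h1 := Equiv.ext_iff.1 e' a
  have h2 := Equiv.ext_iff.1 e' b
  simp only [Equiv.swap_apply_left, Equiv.swap_apply_right, Equiv.swap_apply_def] at h1 h2
  simp only [Subtype.mk.injEq, Prod.mk.injEq]
  grind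

/-- The last letter of a labelled chain from η to ζ starts at some ξ in between. The cover leaves ξ
= η, as ξ = ζ is excluded by rank. -/
theorem RelCovers.exists_upStep {η ζ : SInf} (h : RelCovers UBLE η ζ) :
    ∃ g : GenIdx, UpStep η⁻¹.1 g.1.1 g.1.2 ∧ ζ = transp g.1.1 g.1.2 * η := by
  obtain ⟨h1, h2, h3⟩ := h
  obtain ⟨w, hw⟩ := uble_iff.1 h1
  cases w with
  | nil => exact absurd (show ζ = η from hw).symm h2
  | cons g w =>
    obtain ⟨ξ, p1, p2, rfl⟩ := hw
    have hp := p2.isPath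
    rcases h3 ξ (uble_iff.2 ⟨w, p1⟩) (uble_iff.2 ⟨_, hp⟩) with e | e
    · subst e
      exact ⟨g, p2, rfl⟩
    · have := hp.rankU_eq
      rw [← e] at this
      simp at this

theorem UpStep.relCovers {ζ : SInf} {g : GenIdx} (h : UpStep ζ⁻¹.1 g.1.1 g.1.2) :
    RelCovers UBLE ζ (transp g.1.1 g.1.2 * ζ) := by
  have hr := h.isPath.rankU_eq
  rw [List.length_singleton] at hr
  refine ⟨uble_iff.2 ⟨_, h.isPath⟩, fun e => ?_, fun c h1 h2 => ?_⟩
  · rw [← e] at hr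
    omega
  · by_cases hc : rankU c ≤ rankU ζ
    · exact Or.inl (uble_eq_of_rankU_le h1 hc).symm
    · exact Or.inr (uble_eq_of_rankU_le h2 (by omega))

theorem relCovers_iff {ζ : SInf} {g : GenIdx} :
    RelCovers UBLE ζ (transp g.1.1 g.1.2 * ζ) ↔ UpStep ζ⁻¹.1 g.1.1 g.1.2 := by
  refine ⟨fun h => ?_, UpStep.relCovers⟩
  obtain ⟨g', h1, h2⟩ := h.exists_upStep
  rwa [genIdx_eq_of_transp_eq (mul_right_cancel h2)]

theorem isRankedBy_rankU : IsRankedBy UBLE rankU where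
  strict a b h hne := not_le.1 fun hr => hne (uble_eq_of_rankU_le h hr)
  covers a b h := by
    obtain ⟨g, h1, rfl⟩ := h.exists_upStep
    exact h1.isPath.rankU_eq
  minimal a h := by rw [← h 1 (one_uble a), rankU_one]

/-! ### Translation of intervals and of chains -/

/-- Right translation between intervals. -/
def intervalIso {r s : SInf → SInf → Prop} {a b c d : SInf} (u : SInf)
    (hmem : ∀ ξ, ξ ∈ relInterval r a b ↔ ξ * u ∈ relInterval s c d)
    (hrel : ∀ ξ ∈ relInterval r a b, ∀ ξ' ∈ relInterval r a b, r ξ ξ' ↔ s (ξ * u) (ξ' * u)) :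
    Subrel r (· ∈ relInterval r a b) ≃r Subrel s (· ∈ relInterval s c d) where
  toFun ξ := ⟨ξ * u, (hmem ξ).1 ξ.2⟩
  invFun σ := ⟨σ * u⁻¹, (hmem _).2 (by rw [inv_mul_cancel_right]; exact σ.2)⟩
  left_inv ξ := Subtype.ext (mul_inv_cancel_right _ _)
  right_inv ξ := Subtype.ext (inv_mul_cancel_right _ _)
  map_rel_iff' := fun {ξ ξ'} => (hrel ξ.1 ξ.2 ξ'.1 ξ'.2).symm

theorem exists_kInterval_iso {k : ℕ} {ζ u : SInf} (h : KLE k u (ζ * u)) :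
    ∃ e : Subrel UBLE (· ∈ relInterval UBLE 1 ζ) ≃r
        Subrel (KLE k) (· ∈ relInterval (KLE k) u (ζ * u)),
      ∀ ξ, (e ξ : SInf) = (ξ : SInf) * u := by
  have hmem : ∀ ξ, ξ ∈ relInterval UBLE 1 ζ ↔ ξ * u ∈ relInterval (KLE k) u (ζ * u) := by
    intro ξ
    simp only [relInterval, Set.mem_ofPred_eq, one_uble, true_and]
    exact uble_iff_kle h
  refine ⟨intervalIso u hmem fun ξ hξ ξ' hξ' => ?_, fun ξ => rfl⟩
  have h2 := ((hmem ξ').1 hξ').1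
  rw [uble_iff_kle h2]
  exact and_iff_right ((hmem ξ).1 hξ).1

theorem uble_translate {k : ℕ} {u η ζ : SInf} (h1 : KLE k u (η * u))
    (h2 : KLE k (η * u) (ζ * (η * u))) : UBLE η (ζ * η) := by
  refine (uble_iff_kle (k := k) (u := u) ?_).2 ⟨h1, ?_⟩
  · rw [mul_assoc]; exact h1.trans h2
  · rwa [mul_assoc]

/-- If u and k witness η ≼ ζ, both intervals are copies of [ηu, ζu]ₖ: the first through the base ηu,
the second through the base u. -/
theorem exists_interval_iso {η ζ : SInf} (h : UBLE η ζ) :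
    ∃ e : Subrel UBLE (· ∈ relInterval UBLE 1 (ζ * η⁻¹)) ≃r
        Subrel UBLE (· ∈ relInterval UBLE η ζ),
      ∀ ξ, (e ξ : SInf) = (ξ : SInf) * η := by
  obtain ⟨u, k, h1, h2⟩ := h
  have h3 : KLE k (η * u) (ζ * η⁻¹ * (η * u)) := by
    rwa [← mul_assoc, inv_mul_cancel_right]
  have h4 : KLE k u (ζ * u) := Relation.ReflTransGen.trans h1 h2
  have key : ∀ ξ, UBLE ξ (ζ * η⁻¹) ↔
      KLE k (η * u) (ξ * (η * u)) ∧ KLE k (ξ * (η * u)) (ζ * u) := by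
    intro ξ
    rw [uble_iff_kle h3, ← mul_assoc (ζ * η⁻¹), inv_mul_cancel_right]
  have hmem : ∀ ξ, ξ ∈ relInterval UBLE 1 (ζ * η⁻¹) ↔ ξ * η ∈ relInterval UBLE η ζ := by
    intro ξ
    simp only [relInterval, Set.mem_ofPred_eq, one_uble, true_and]
    rw [key, uble_iff_kle h4, mul_assoc]
    constructor
    · rintro ⟨h5, h6⟩
      exact ⟨uble_translate h1 h5, h1.trans h5, h6⟩
    · rintro ⟨h5, h6, h7⟩
      rw [← mul_assoc] at h6
      rw [← mul_assoc]
      exact ⟨((uble_iff_kle h6).1 h5).2, by rwa [mul_assoc]⟩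
  refine ⟨intervalIso η hmem fun ξ hξ ξ' hξ' => ?_, fun ξ => rfl⟩
  have a := ((key ξ).1 hξ.2).1
  have a' := ((key ξ').1 hξ'.2).1
  rw [uble_iff_kle a']
  have a'' : KLE k u (ξ' * η * u) := by rw [mul_assoc]; exact h1.trans a'
  rw [uble_iff_kle a'', mul_assoc, mul_assoc]
  exact ⟨fun h => ⟨h1.trans a, h.2⟩, fun h => ⟨a, h.2⟩⟩

/-- Words label chains from `η` exactly when they label chains from `1` that end in `[1, ζ η⁻¹]`. -/
theorem isPath_translate {η ζ : SInf} (h : UBLE η ζ) {w : List GenIdx} :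
    IsPath η w ζ ↔ IsPath 1 w (ζ * η⁻¹) := by
  obtain ⟨u, k, h1, h2⟩ := h
  -- The permutation ηu is a base for ζη⁻¹ with the same k, so both sides speak of the same chains
  -- from ηu to ζu.
  have h3 : KLE k (η * u) (ζ * η⁻¹ * (η * u)) := by
    rwa [← mul_assoc, inv_mul_cancel_right]
  rw [isPath_iff_isKPath h3, isPath_iff_isKPath (Relation.ReflTransGen.trans h1 h2), one_mul,
    ← mul_assoc, inv_mul_cancel_right]
  exact ⟨fun h => ⟨.refl, h.2⟩, fun h => ⟨h1, h.2⟩⟩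

/-- An atom `(α β)` below `ζ` starts a chain up to `ζ`. -/
theorem exists_isPath_concat {ζ : SInf} {g : GenIdx} (h : DownStep ζ.1 g.1.1 g.1.2) :
    ∃ v, IsPath 1 v (ζ * transp g.1.1 g.1.2) ∧ IsPath 1 (v ++ [g]) ζ := by
  obtain ⟨u, k, hc⟩ := exists_bruhatCrit ζ
  have e1 := val_inv_apply u g.1.1
  have e2 := val_inv_apply u g.1.2
  have hz : (ζ * u).1 * u.1⁻¹ = ζ.1 := mul_inv_cancel_right ζ.1 u.1
  obtain ⟨h1, h2, h3, h4⟩ := hc.atom (i := u⁻¹.1 g.1.1) (j := u⁻¹.1 g.1.2) (by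
    rw [e1, e2, hz]; exact h)
  rw [e1, e2] at h3
  have hs : IsKStep k u g (transp g.1.1 g.1.2 * u) := ⟨h1, h2, h3, rfl⟩
  have hk1 : KLE k u (transp g.1.1 g.1.2 * u) := .single (kCover_iff.2 ⟨_, hs⟩)
  have hk2 : KLE k (transp g.1.1 g.1.2 * u) (ζ * u) := by
    rw [kle_iff_crit, transp_mul_SInf]
    exact h4
  have hub : UBLE (transp g.1.1 g.1.2) ζ := ⟨u, k, hk1, hk2⟩
  obtain ⟨v, hv⟩ := uble_iff.1 hub
  -- The word v leads from the atom to ζ. Translated, it leads from 1 to ζ(α β); preceded by the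
  -- atom, it leads from 1 to ζ.
  refine ⟨v, ?_, ?_⟩
  · have := (isPath_translate hub).1 hv
    rwa [transp_inv] at this
  · refine IsPath.append ((isPath_iff_isKPath hk1).2 ?_) hv
    rw [one_mul]
    exact ⟨.refl, _, rfl, hs⟩

/-! ### The operators on basis vectors -/

theorem uHat_basisVec_of_upStep {g : GenIdx} {ζ : SInf} (h : UpStep ζ⁻¹.1 g.1.1 g.1.2) :
    uHat g (basisVec ζ) = basisVec (transp g.1.1 g.1.2 * ζ) := by
  replace h := relCovers_iff.2 h
  simp [uHat, basisVec, h]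

theorem uHat_basisVec_of_not_upStep {g : GenIdx} {ζ : SInf} (h : ¬ UpStep ζ⁻¹.1 g.1.1 g.1.2) :
    uHat g (basisVec ζ) = 0 := by
  replace h := mt relCovers_iff.1 h
  simp [uHat, basisVec, h]

theorem basisVec_injective : Function.Injective basisVec :=
  fun _ _ h => (Finsupp.single_left_inj (one_ne_zero (α := ℚ))).1 h

theorem basisVec_ne_zero (ζ : SInf) : basisVec ζ ≠ 0 :=
  Finsupp.single_ne_zero.2 one_ne_zero

theorem hatWord_cons (g : GenIdx) (w : List GenIdx) : hatWord (g :: w) = uHat g * hatWord w := by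
  simp [hatWord]

theorem IsPath.hatWord {η ζ : SInf} {w : List GenIdx} (h : IsPath η w ζ) :
    hatWord w (basisVec η) = basisVec ζ := by
  induction w generalizing ζ with
  | nil => cases (show ζ = η from h); simp [_root_.hatWord]
  | cons g w ih =>
    obtain ⟨ξ, h1, h2, rfl⟩ := h
    rw [hatWord_cons, Module.End.mul_apply, ih h1, uHat_basisVec_of_upStep h2]

theorem hatWord_eq_zero_of_forall_not_isPath {η : SInf} {w : List GenIdx}
    (h : ∀ ζ, ¬ IsPath η w ζ) : hatWord w (basisVec η) = 0 := by
  induction w with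
  | nil => exact absurd rfl (h η)
  | cons g w ih =>
    rw [hatWord_cons, Module.End.mul_apply]
    by_cases hw : ∃ ξ, IsPath η w ξ
    · obtain ⟨ξ, hξ⟩ := hw
      rw [hξ.hatWord]
      exact uHat_basisVec_of_not_upStep fun hu => h _ ⟨ξ, hξ, hu, rfl⟩
    · rw [ih (not_exists.1 hw), map_zero]

theorem hatWord_eq_basisVec_iff {η ζ : SInf} {w : List GenIdx} :
    hatWord w (basisVec η) = basisVec ζ ↔ IsPath η w ζ := by
  refine ⟨fun h => ?_, IsPath.hatWord⟩
  by_cases hw : ∃ ξ, IsPath η w ξ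
  · obtain ⟨ξ, hξ⟩ := hw
    rw [hξ.hatWord] at h
    rwa [← basisVec_injective h]
  · rw [hatWord_eq_zero_of_forall_not_isPath (not_exists.1 hw)] at h
    exact absurd h.symm (basisVec_ne_zero ζ)

theorem hatWord_eq_zero_iff {η : SInf} {w : List GenIdx} :
    hatWord w (basisVec η) = 0 ↔ ∀ ζ, ¬ IsPath η w ζ := by
  refine ⟨fun h ζ hζ => ?_, hatWord_eq_zero_of_forall_not_isPath⟩
  rw [hζ.hatWord] at h
  exact basisVec_ne_zero ζ h

theorem IsPath.unique {η ζ ζ' : SInf} {w : List GenIdx} (h : IsPath η w ζ) (h' : IsPath η w ζ') :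
    ζ = ζ' :=
  basisVec_injective (h.hatWord.symm.trans h'.hatWord)

/-- A chain from η to ζ is translated to one from 1 to ζη⁻¹, exchanged there, and translated back.
The return is allowed because η ≼ ζ is already known. -/
theorem isPath_of_hatWord_one_eq {w w' : List GenIdx}
    (h : hatWord w (basisVec 1) = hatWord w' (basisVec 1)) {η ζ : SInf} (hw : IsPath η w ζ) :
    IsPath η w' ζ := by
  have hu : UBLE η ζ := uble_iff.2 ⟨w, hw⟩
  rw [isPath_translate hu] at hw ⊢
  rw [hw.hatWord] at h
  exact hatWord_eq_basisVec_iff.1 h.symm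

theorem hatWord_eq_iff {w w' : List GenIdx} :
    hatWord w = hatWord w' ↔ hatWord w (basisVec 1) = hatWord w' (basisVec 1) := by
  refine ⟨fun h => by rw [h], fun h => Finsupp.lhom_ext' fun η => LinearMap.ext_ring ?_⟩
  change hatWord w (basisVec η) = hatWord w' (basisVec η)
  by_cases hw : ∃ ζ, IsPath η w ζ
  · obtain ⟨ζ, hζ⟩ := hw
    rw [hζ.hatWord, (isPath_of_hatWord_one_eq h hζ).hatWord]
  · have hw' : ∀ ζ, ¬ IsPath η w' ζ := fun ζ hζ =>
      hw ⟨ζ, isPath_of_hatWord_one_eq h.symm hζ⟩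
    rw [hatWord_eq_zero_iff.2 (not_exists.1 hw), hatWord_eq_zero_iff.2 hw']

theorem hatWord_eq_zero {w : List GenIdx} (h : hatWord w (basisVec 1) = 0) : hatWord w = 0 := by
  refine Finsupp.lhom_ext' fun η => LinearMap.ext_ring ?_
  change hatWord w (basisVec η) = 0
  rw [hatWord_eq_zero_iff] at h ⊢
  exact fun ζ hζ => h _ ((isPath_translate (uble_iff.2 ⟨w, hζ⟩)).1 hζ)

/-! ### The operators satisfy the relations -/

theorem transp_inv_apply (a b c : ℕ+) :
    (transp a b)⁻¹.1 c = if c = a then b else if c = b then a else c := by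
  rw [transp_inv]
  exact Equiv.swap_apply_def a b c

theorem transp_mul_inv_apply (ζ : SInf) (a b c : ℕ+) :
    (transp a b * ζ)⁻¹.1 c = ζ⁻¹.1 (if c = a then b else if c = b then a else c) := by
  rw [← Equiv.swap_apply_def, mul_inv_rev, transp_inv]
  rfl

theorem one_inv_apply (c : ℕ+) : (1 : SInf)⁻¹.1 c = c := by
  rw [inv_one]
  rfl

theorem isPath_two {g h : GenIdx} {ζ : SInf} :
    IsPath 1 [g, h] ζ ↔ UpStep (1 : SInf)⁻¹.1 h.1.1 h.1.2 ∧
      UpStep (transp h.1.1 h.1.2 * 1)⁻¹.1 g.1.1 g.1.2 ∧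
      ζ = transp g.1.1 g.1.2 * (transp h.1.1 h.1.2 * 1) := by
  constructor
  · rintro ⟨ξ, ⟨η, rfl, h2, rfl⟩, h3⟩
    exact ⟨h2, h3⟩
  · rintro ⟨h1, h2⟩
    exact ⟨_, ⟨1, rfl, h1, rfl⟩, h2⟩

theorem isPath_three {g h k : GenIdx} {ζ : SInf} :
    IsPath 1 [g, h, k] ζ ↔ UpStep (1 : SInf)⁻¹.1 k.1.1 k.1.2 ∧
      UpStep (transp k.1.1 k.1.2 * 1)⁻¹.1 h.1.1 h.1.2 ∧
      UpStep (transp h.1.1 h.1.2 * (transp k.1.1 k.1.2 * 1))⁻¹.1 g.1.1 g.1.2 ∧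
      ζ = transp g.1.1 g.1.2 * (transp h.1.1 h.1.2 * (transp k.1.1 k.1.2 * 1)) := by
  constructor
  · rintro ⟨ξ, ⟨η, ⟨_, rfl, h2, rfl⟩, h3, rfl⟩, h4⟩
    exact ⟨h2, h3, h4⟩
  · rintro ⟨h1, h2, h3⟩
    exact ⟨_, ⟨_, ⟨1, rfl, h1, rfl⟩, h2, rfl⟩, h3⟩

section Relations

variable {α β γ δ : ℕ+}

theorem inv_apply_injective {ζ η : SInf} (h : ∀ c, ζ⁻¹.1 c = η⁻¹.1 c) : ζ = η := by
  rw [← inv_inj]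
  exact Subtype.ext (Equiv.ext h)

theorem transp_shared_left (h₁ : α < β) (h₂ : β < γ) (h₃ : γ < δ) :
    transp β γ * transp γ δ * transp α γ = transp β δ * transp α β * transp β γ := by
  apply inv_apply_injective
  intro c
  simp only [mul_assoc, transp_mul_inv_apply, transp_inv_apply]
  grind

theorem transp_shared_right (h₁ : α < β) (h₂ : β < γ) (h₃ : γ < δ) :
    transp α γ * transp γ δ * transp β γ = transp β γ * transp α β * transp β δ := by
  apply inv_apply_injective
  intro c
  simp only [mul_assoc, transp_mul_inv_apply, transp_inv_apply]
  grind

theorem transp_comm (h₁ : α < β) (h₂ : γ < δ)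
    (h : β < γ ∨ δ < α ∨ (α < γ ∧ δ < β) ∨ (γ < α ∧ β < δ)) :
    transp α β * transp γ δ = transp γ δ * transp α β := by
  apply inv_apply_injective
  intro c
  simp only [transp_mul_inv_apply, transp_inv_apply]
  grind

theorem hatWord_rel_shared_left (h₁ : α < β) (h₂ : β < γ) (h₃ : γ < δ) :
    hatWord [genIdx h₂, genIdx h₃, genIdx (h₁.trans h₂)] =
      hatWord [genIdx (h₂.trans h₃), genIdx h₁, genIdx h₂] := by
  rw [hatWord_eq_iff]
  have p : IsPath 1 [genIdx h₂, genIdx h₃, genIdx (h₁.trans h₂)] _ := isPath_three.2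
    ⟨by simp only [UpStep, genIdx, one_inv_apply]; grind,
     by simp only [UpStep, genIdx, transp_mul_inv_apply, one_inv_apply]; grind,
     by simp only [UpStep, genIdx, transp_mul_inv_apply, one_inv_apply]; grind, rfl⟩
  have q : IsPath 1 [genIdx (h₂.trans h₃), genIdx h₁, genIdx h₂] _ := isPath_three.2
    ⟨by simp only [UpStep, genIdx, one_inv_apply]; grind,
     by simp only [UpStep, genIdx, transp_mul_inv_apply, one_inv_apply]; grind,
     by simp only [UpStep, genIdx, transp_mul_inv_apply, one_inv_apply]; grind, rfl⟩
  rw [p.hatWord, q.hatWord]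
  simp only [genIdx, mul_one, ← mul_assoc]
  rw [transp_shared_left h₁ h₂ h₃]

theorem hatWord_rel_shared_right (h₁ : α < β) (h₂ : β < γ) (h₃ : γ < δ) :
    hatWord [genIdx (h₁.trans h₂), genIdx h₃, genIdx h₂] =
      hatWord [genIdx h₂, genIdx h₁, genIdx (h₂.trans h₃)] := by
  rw [hatWord_eq_iff]
  have p : IsPath 1 [genIdx (h₁.trans h₂), genIdx h₃, genIdx h₂] _ := isPath_three.2
    ⟨by simp only [UpStep, genIdx, one_inv_apply]; grind,
     by simp only [UpStep, genIdx, transp_mul_inv_apply, one_inv_apply]; grind,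
     by simp only [UpStep, genIdx, transp_mul_inv_apply, one_inv_apply]; grind, rfl⟩
  have q : IsPath 1 [genIdx h₂, genIdx h₁, genIdx (h₂.trans h₃)] _ := isPath_three.2
    ⟨by simp only [UpStep, genIdx, one_inv_apply]; grind,
     by simp only [UpStep, genIdx, transp_mul_inv_apply, one_inv_apply]; grind,
     by simp only [UpStep, genIdx, transp_mul_inv_apply, one_inv_apply]; grind, rfl⟩
  rw [p.hatWord, q.hatWord]
  simp only [genIdx, mul_one, ← mul_assoc]
  rw [transp_shared_right h₁ h₂ h₃]

theorem hatWord_rel_comm (h₁ : α < β) (h₂ : γ < δ) (h : β < γ ∨ (α < γ ∧ δ < β)) :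
    hatWord [genIdx h₁, genIdx h₂] = hatWord [genIdx h₂, genIdx h₁] := by
  rw [hatWord_eq_iff]
  have p : IsPath 1 [genIdx h₁, genIdx h₂] _ := isPath_two.2
    ⟨by simp only [UpStep, genIdx, one_inv_apply]; grind,
     by simp only [UpStep, genIdx, transp_mul_inv_apply, one_inv_apply]; grind, rfl⟩
  have q : IsPath 1 [genIdx h₂, genIdx h₁] _ := isPath_two.2
    ⟨by simp only [UpStep, genIdx, one_inv_apply]; grind,
     by simp only [UpStep, genIdx, transp_mul_inv_apply, one_inv_apply]; grind, rfl⟩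
  rw [p.hatWord, q.hatWord]
  simp only [genIdx, mul_one]
  rw [transp_comm h₁ h₂ (by tauto)]

theorem hatWord_rel_cross (h₁ : α ≤ β) (h₂ : β < γ) (h₃ : γ ≤ δ) :
    hatWord [genIdx (h₁.trans_lt h₂), genIdx (h₂.trans_le h₃)] = 0 := by
  refine hatWord_eq_zero (hatWord_eq_zero_iff.2 fun ζ h => ?_)
  have h' := (isPath_two.1 h).2.1
  simp only [UpStep, genIdx, transp_mul_inv_apply, one_inv_apply] at h'
  -- After the first step ζ⁻¹ takes the value δ at β, which violates the bound if β = α and the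
  -- betweenness if α < β.
  have := h'.2.2.2 β
  grind

theorem hatWord_rel_cross' (h₁ : α ≤ β) (h₂ : β < γ) (h₃ : γ ≤ δ) :
    hatWord [genIdx (h₂.trans_le h₃), genIdx (h₁.trans_lt h₂)] = 0 := by
  refine hatWord_eq_zero (hatWord_eq_zero_iff.2 fun ζ h => ?_)
  have h' := (isPath_two.1 h).2.1
  simp only [UpStep, genIdx, transp_mul_inv_apply, one_inv_apply] at h'
  -- Here ζ⁻¹ takes the value α at γ: too small for the bound if γ = δ, and for the betweenness if γ
  -- < δ.
  have := h'.2.2.2 γ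
  grind

theorem hatWord_rel_braid (h₁ : α < β) (h₂ : β < γ) :
    hatWord [genIdx h₂, genIdx h₁, genIdx h₂] = 0 := by
  refine hatWord_eq_zero (hatWord_eq_zero_iff.2 fun ζ h => ?_)
  have h' := (isPath_three.1 h).2.2.1
  simp only [UpStep, genIdx, transp_mul_inv_apply, one_inv_apply] at h'
  grind

theorem hatWord_rel_braid' (h₁ : α < β) (h₂ : β < γ) :
    hatWord [genIdx h₁, genIdx h₂, genIdx h₁] = 0 := by
  refine hatWord_eq_zero (hatWord_eq_zero_iff.2 fun ζ h => ?_)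
  have h' := (isPath_three.1 h).2.2.1
  simp only [UpStep, genIdx, transp_mul_inv_apply, one_inv_apply] at h'
  grind

theorem eq_of_mRel_uHat {X Y : Module.End ℚ QSInf} (h : MRel uHat X Y) : X = Y := by
  cases h with
  | rel1 h₁ h₂ h₃ => simpa [hatWord, mul_assoc] using hatWord_rel_shared_left h₁ h₂ h₃
  | rel2 h₁ h₂ h₃ => simpa [hatWord, mul_assoc] using hatWord_rel_shared_right h₁ h₂ h₃
  | rel3 h₁ h₂ h => simpa [hatWord] using hatWord_rel_comm h₁ h₂ h
  | rel4 h₁ h₂ h₃ => simpa [hatWord] using hatWord_rel_cross h₁ h₂ h₃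
  | rel4' h₁ h₂ h₃ => simpa [hatWord] using hatWord_rel_cross' h₁ h₂ h₃
  | rel5 h₁ h₂ => simpa [hatWord, mul_assoc] using hatWord_rel_braid h₁ h₂
  | rel5' h₁ h₂ => simpa [hatWord, mul_assoc] using hatWord_rel_braid' h₁ h₂

end Relations

/-! ### Words and maximal chains -/

theorem IsPath.exists_of_suffix {η ζ : SInf} {v w : List GenIdx} (h : IsPath η w ζ)
    (hv : v <:+ w) : ∃ ξ, IsPath η v ξ ∧ UBLE ξ ζ := by
  obtain ⟨t, rfl⟩ := hv
  induction t generalizing ζ with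
  | nil => exact ⟨ζ, h, uble_refl ζ⟩
  | cons g t ih =>
    obtain ⟨σ, h1, h2, rfl⟩ := h
    obtain ⟨ξ, h3, h4⟩ := ih h1
    exact ⟨ξ, h3, uble_trans h4 (uble_iff.2 ⟨_, h2.isPath⟩)⟩

theorem mem_wordChain {w : List GenIdx} {σ : SInf} :
    σ ∈ wordChain w ↔ ∃ v, v <:+ w ∧ IsPath 1 v σ := by
  simp only [wordChain, Set.mem_ofPred_eq, hatWord_eq_basisVec_iff]

theorem mem_reducedSeqs {w : List GenIdx} {ζ : SInf} : w ∈ reducedSeqs ζ ↔ IsPath 1 w ζ :=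
  hatWord_eq_basisVec_iff

theorem wordChain_cons {g : GenIdx} {w : List GenIdx} {ζ : SInf} (h : IsPath 1 (g :: w) ζ) :
    wordChain (g :: w) = insert ζ (wordChain w) := by
  ext σ
  simp only [Set.mem_insert_iff, mem_wordChain, List.suffix_cons_iff]
  constructor
  · rintro ⟨v, rfl | hv, hp⟩
    · exact Or.inl (hp.unique h)
    · exact Or.inr ⟨v, hv, hp⟩
  · rintro (rfl | ⟨v, hv, hp⟩)
    · exact ⟨_, Or.inl rfl, h⟩
    · exact ⟨v, Or.inr hv, hp⟩

theorem uble_of_mem_wordChain {w : List GenIdx} {ζ σ : SInf} (h : IsPath 1 w ζ)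
    (hσ : σ ∈ wordChain w) : UBLE σ ζ := by
  obtain ⟨v, hv, hp⟩ := mem_wordChain.1 hσ
  obtain ⟨ξ, h1, h2⟩ := h.exists_of_suffix hv
  rwa [hp.unique h1]

theorem self_mem_wordChain {w : List GenIdx} {ζ : SInf} (h : IsPath 1 w ζ) : ζ ∈ wordChain w :=
  mem_wordChain.2 ⟨w, List.suffix_rfl, h⟩

theorem isChain_wordChain {w : List GenIdx} {ζ : SInf} (h : IsPath 1 w ζ) :
    IsChain UBLE (wordChain w) := by
  induction w generalizing ζ with
  | nil =>
    intro a ha b hb hab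
    have key : ∀ c ∈ wordChain [], c = 1 := fun c hc => by
      obtain ⟨v, hv, hp⟩ := mem_wordChain.1 hc
      cases List.suffix_nil.1 hv
      exact hp
    exact absurd ((key a ha).trans (key b hb).symm) hab
  | cons g w ih =>
    rw [wordChain_cons h]
    obtain ⟨ξ, h1, h2, rfl⟩ := h
    refine (ih h1).insert fun b hb _ => Or.inr ?_
    exact uble_trans (uble_of_mem_wordChain h1 hb) (uble_iff.2 ⟨_, h2.isPath⟩)

/-- The chain of a word of length `n` has an element of every rank up to `n`. -/
theorem exists_mem_wordChain_rankU {w : List GenIdx} {ζ : SInf} (h : IsPath 1 w ζ) {n : ℕ}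
    (hn : n ≤ w.length) : ∃ σ ∈ wordChain w, rankU σ = n := by
  obtain ⟨ξ, h1, -⟩ := h.exists_of_suffix (List.drop_suffix (w.length - n) w)
  refine ⟨ξ, mem_wordChain.2 ⟨_, List.drop_suffix _ _, h1⟩, ?_⟩
  rw [rankU_eq h1, List.length_drop]
  omega

/-- The chain has a member of every rank up to that of ζ, and comparable elements of equal rank
coincide, so nothing can be added. -/
theorem wordChain_mem_maximalChains {w : List GenIdx} {ζ : SInf} (h : IsPath 1 w ζ) :
    wordChain w ∈ maximalChains UBLE 1 ζ := by
  refine ⟨⟨fun σ hσ => ⟨one_uble σ, uble_of_mem_wordChain h hσ⟩, isChain_wordChain h⟩, ?_⟩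
  rintro D ⟨hD, hc⟩ hle σ hσ
  have hr : rankU σ ≤ w.length := by
    rw [← rankU_eq h]
    exact uble_rankU_le (hD hσ).2
  obtain ⟨τ, hτ, he⟩ := exists_mem_wordChain_rankU h hr
  by_cases hne : σ = τ
  · rwa [hne]
  · rcases hc hσ (hle hτ) hne with h1 | h1
    · exact absurd (uble_eq_of_rankU_le h1 he.le) hne
    · exact absurd (uble_eq_of_rankU_le h1 he.ge).symm hne

theorem wordChain_of_cons {g : GenIdx} {w : List GenIdx} {ζ : SInf} (h : IsPath 1 (g :: w) ζ) :
    wordChain w = {σ ∈ wordChain (g :: w) | rankU σ < rankU ζ} := by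
  rw [wordChain_cons h]
  obtain ⟨ξ, h1, h2, rfl⟩ := h
  have hr := h2.isPath.rankU_eq
  rw [List.length_singleton] at hr
  ext σ
  simp only [Set.mem_insert_iff, Set.mem_ofPred_eq]
  constructor
  · intro hσ
    have := uble_rankU_le (uble_of_mem_wordChain h1 hσ)
    exact ⟨Or.inr hσ, by omega⟩
  · rintro ⟨rfl | hσ, hlt⟩
    · exact absurd hlt (lt_irrefl _)
    · exact hσ

theorem end_eq_of_wordChain_eq {w w' : List GenIdx} {ζ ζ' : SInf} (h : IsPath 1 w ζ)
    (h' : IsPath 1 w' ζ') (e : wordChain w = wordChain w') : ζ = ζ' :=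
  uble_antisymm (uble_of_mem_wordChain h' (e ▸ self_mem_wordChain h))
    (uble_of_mem_wordChain h (e ▸ self_mem_wordChain h'))

/-- The chain determines its top, and its elements of smaller rank form the chain of the tail. The
last letter is then determined by the two highest elements. -/
theorem eq_of_wordChain_eq {w w' : List GenIdx} {ζ ζ' : SInf} (h : IsPath 1 w ζ)
    (h' : IsPath 1 w' ζ') (e : wordChain w = wordChain w') : w = w' := by
  induction w generalizing w' ζ ζ' with
  | nil =>
    cases end_eq_of_wordChain_eq h h' e
    have := (rankU_eq h).symm.trans (rankU_eq h')
    exact (List.eq_nil_of_length_eq_zero this.symm).symm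
  | cons g w ih =>
    cases end_eq_of_wordChain_eq h h' e
    have hl := (rankU_eq h).symm.trans (rankU_eq h')
    cases w' with
    | nil => simp at hl
    | cons g' w' =>
      have e' : wordChain w = wordChain w' := by
        rw [wordChain_of_cons h, wordChain_of_cons h', e]
      obtain ⟨ξ, h1, -, h2⟩ := h
      obtain ⟨ξ', h1', -, h2'⟩ := h'
      cases ih h1 h1' e'
      cases h1.unique h1'
      rw [genIdx_eq_of_transp_eq (mul_right_cancel (h2.symm.trans h2'))]

theorem maximalChains_insert {ζ : SInf} {C : Set SInf} (hC : C ∈ maximalChains UBLE 1 ζ)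
    {τ : SInf} (hτ : UBLE τ ζ) (h : ∀ σ ∈ C, UBLE σ τ ∨ UBLE τ σ) : τ ∈ C := by
  refine hC.2 (y := insert τ C) ⟨?_, ?_⟩ (Set.subset_insert _ _) (Set.mem_insert _ _)
  · exact Set.insert_subset ⟨one_uble τ, hτ⟩ hC.1.1
  · exact hC.1.2.insert fun σ hσ _ => (h σ hσ).symm

theorem exists_word_of_maximalChain {ζ : SInf} {C : Set SInf}
    (hC : C ∈ maximalChains UBLE 1 ζ) : ∃ w, IsPath 1 w ζ ∧ wordChain w = C := by
  induction hn : rankU ζ using Nat.strong_induction_on generalizing ζ C with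
  | _ n ih =>
    have hζC : ζ ∈ C := maximalChains_insert hC (uble_refl ζ) fun σ hσ => Or.inl (hC.1.1 hσ).2
    have h1C : 1 ∈ C := maximalChains_insert hC (one_uble ζ) fun σ hσ => Or.inr (one_uble σ)
    by_cases hζ : ζ = 1
    · subst hζ
      refine ⟨[], rfl, Set.eq_of_subset_of_subset (fun σ hσ => ?_) fun σ hσ => ?_⟩
      · obtain ⟨v, hv, hp⟩ := mem_wordChain.1 hσ
        cases List.suffix_nil.1 hv
        rwa [show σ = 1 from hp]
      · rw [uble_antisymm (hC.1.1 hσ).2 (one_uble σ)]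
        exact self_mem_wordChain rfl
    -- Ranks in C are bounded, so C without ζ has an element ξ of greatest rank, and comparability
    -- makes it the greatest element.
    · let S : Set ℕ := rankU '' (C \ {ζ})
      have hS : S.Finite := (Set.finite_Iic (rankU ζ)).subset (by
        rintro _ ⟨σ, hσ, rfl⟩
        exact uble_rankU_le (hC.1.1 hσ.1).2)
      obtain ⟨m, ⟨ξ, hξ, rfl⟩, hmax⟩ := hS.exists_maximal
        ⟨rankU 1, 1, ⟨h1C, fun h => hζ h.symm⟩, rfl⟩
      have hle : ∀ σ ∈ C, σ ≠ ζ → UBLE σ ξ := by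
        intro σ hσ hne
        by_cases hσξ : σ = ξ
        · rw [hσξ]; exact uble_refl ξ
        · rcases hC.1.2 hσ hξ.1 hσξ with h | h
          · exact h
          · have := hmax ⟨σ, ⟨hσ, hne⟩, rfl⟩ (uble_rankU_le h)
            exact absurd (uble_eq_of_rankU_le h this).symm hσξ
      have hcov : RelCovers UBLE ξ ζ := by
        refine ⟨(hC.1.1 hξ.1).2, hξ.2, fun τ h1 h2 => ?_⟩
        by_cases hτ : τ = ζ
        · exact Or.inr hτ
        · left
          -- Anything between ξ and ζ is comparable with all of C, hence belongs to C by maximality.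
          have hτC : τ ∈ C := maximalChains_insert hC h2 fun σ hσ => by
            by_cases hσζ : σ = ζ
            · right; rwa [hσζ]
            · left; exact uble_trans (hle σ hσ hσζ) h1
          exact (uble_antisymm h1 (hle τ hτC hτ)).symm
      obtain ⟨g, hg, hgζ⟩ := hcov.exists_upStep
      have hr : rankU ζ = rankU ξ + 1 := isRankedBy_rankU.covers _ _ hcov
      have hC' : C \ {ζ} ∈ maximalChains UBLE 1 ξ := by
        refine ⟨⟨fun σ hσ => ⟨one_uble σ, hle σ hσ.1 hσ.2⟩, hC.1.2.mono Set.sdiff_subset⟩, ?_⟩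
        rintro D ⟨hD, hc⟩ hCD τ hτ
        have hτξ := (hD hτ).2
        refine ⟨maximalChains_insert hC (uble_trans hτξ hcov.1) fun σ hσ => ?_, ?_⟩
        · by_cases hσζ : σ = ζ
          · right; rw [hσζ]; exact uble_trans hτξ hcov.1
          · by_cases hστ : σ = τ
            · left; rw [hστ]; exact uble_refl τ
            · exact hc (hCD ⟨hσ, hσζ⟩) hτ hστ
        · intro h
          have := uble_rankU_le hτξ
          rw [show τ = ζ from h] at this
          omega
      obtain ⟨w, hw, hwC⟩ := ih (rankU ξ) (by omega) hC' rfl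
      have hp : IsPath 1 (g :: w) ζ := ⟨ξ, hw, hg, hgζ⟩
      refine ⟨g :: w, hp, ?_⟩
      rw [wordChain_cons hp, hwC, Set.insert_sdiff_singleton, Set.insert_eq_of_mem hζC]

theorem bijOn_wordChain (ζ : SInf) :
    Set.BijOn wordChain (reducedSeqs ζ) (maximalChains UBLE 1 ζ) :=
  ⟨fun _ hw => wordChain_mem_maximalChains (mem_reducedSeqs.1 hw),
    fun _ hw _ hw' e => eq_of_wordChain_eq (mem_reducedSeqs.1 hw) (mem_reducedSeqs.1 hw') e,
    fun _ hC => by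
      obtain ⟨w, hw, e⟩ := exists_word_of_maximalChain hC
      exact ⟨w, mem_reducedSeqs.2 hw, e⟩⟩

/-! ### Words in the presented monoid -/

/-- The element of the presented monoid given by a word. -/
def wordM (w : List GenIdx) : MMonoid := (w.map MMonoid.gen).prod

theorem wordM_cons (g : GenIdx) (w : List GenIdx) : wordM (g :: w) = MMonoid.gen g * wordM w := by
  simp [wordM]

theorem wordM_append (v w : List GenIdx) : wordM (v ++ w) = wordM v * wordM w := by
  simp [wordM]

theorem mk_eq_of_mRel {a b : WithZero (FreeMonoid GenIdx)} (h : MRel freeGen a b) :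
    MMonoid.mk a = MMonoid.mk b :=
  (Con.eq mCon).2 (ConGen.Rel.of _ _ h)

section Generators

variable {α β γ δ : ℕ+}

theorem gen_shared_left (h₁ : α < β) (h₂ : β < γ) (h₃ : γ < δ) :
    MMonoid.gen (genIdx h₂) * MMonoid.gen (genIdx h₃) * MMonoid.gen (genIdx (h₁.trans h₂)) =
      MMonoid.gen (genIdx (h₂.trans h₃)) * MMonoid.gen (genIdx h₁) * MMonoid.gen (genIdx h₂) :=
  mk_eq_of_mRel (.rel1 h₁ h₂ h₃)

theorem gen_shared_right (h₁ : α < β) (h₂ : β < γ) (h₃ : γ < δ) :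
    MMonoid.gen (genIdx (h₁.trans h₂)) * MMonoid.gen (genIdx h₃) * MMonoid.gen (genIdx h₂) =
      MMonoid.gen (genIdx h₂) * MMonoid.gen (genIdx h₁) * MMonoid.gen (genIdx (h₂.trans h₃)) :=
  mk_eq_of_mRel (.rel2 h₁ h₂ h₃)

theorem gen_comm (h₁ : α < β) (h₂ : γ < δ)
    (h : β < γ ∨ δ < α ∨ (α < γ ∧ δ < β) ∨ (γ < α ∧ β < δ)) :
    MMonoid.gen (genIdx h₁) * MMonoid.gen (genIdx h₂) =
      MMonoid.gen (genIdx h₂) * MMonoid.gen (genIdx h₁) := by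
  rcases h with h | h | h | h
  · exact mk_eq_of_mRel (.rel3 h₁ h₂ (Or.inl h))
  · exact (mk_eq_of_mRel (.rel3 h₂ h₁ (Or.inl h))).symm
  · exact mk_eq_of_mRel (.rel3 h₁ h₂ (Or.inr h))
  · exact (mk_eq_of_mRel (.rel3 h₂ h₁ (Or.inr h))).symm

theorem gen_cross (h₁ : α < β) (h₂ : γ < δ)
    (h : (α ≤ γ ∧ γ < β ∧ β ≤ δ) ∨ (γ ≤ α ∧ α < δ ∧ δ ≤ β)) :
    MMonoid.gen (genIdx h₁) * MMonoid.gen (genIdx h₂) = 0 := by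
  rcases h with ⟨h, h', h''⟩ | ⟨h, h', h''⟩
  · exact mk_eq_of_mRel (.rel4 h h' h'')
  · exact mk_eq_of_mRel (.rel4' h h' h'')

theorem gen_braid (h₁ : α < β) (h₂ : β < γ) :
    MMonoid.gen (genIdx h₂) * MMonoid.gen (genIdx h₁) * MMonoid.gen (genIdx h₂) = 0 :=
  mk_eq_of_mRel (.rel5 h₁ h₂)

theorem gen_braid' (h₁ : α < β) (h₂ : β < γ) :
    MMonoid.gen (genIdx h₁) * MMonoid.gen (genIdx h₂) * MMonoid.gen (genIdx h₁) = 0 :=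
  mk_eq_of_mRel (.rel5' h₁ h₂)

end Generators

/-! ### Down steps after the removal of other labels -/

section DownSteps

variable {x : Equiv.Perm ℕ+} {α β γ δ : ℕ+}

theorem mul_swap_apply (x : Equiv.Perm ℕ+) (a b c : ℕ+) :
    (x * Equiv.swap a b) c = x (if c = a then b else if c = b then a else c) := by
  rw [← Equiv.swap_apply_def]
  rfl

theorem DownStep.comm (h₁ : DownStep x α β) (h₂ : DownStep x γ δ)
    (h : β < γ ∨ δ < α ∨ (α < γ ∧ δ < β) ∨ (γ < α ∧ β < δ)) :
    DownStep (x * Equiv.swap α β) γ δ := by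
  obtain ⟨a1, a2, a3, a4⟩ := h₁
  obtain ⟨b1, b2, b3, b4⟩ := h₂
  simp only [DownStep, mul_swap_apply]
  refine ⟨b1, by grind, by grind, fun ε h1 h2 => ?_⟩
  have := b4 ε
  have := b4 α
  have := b4 β
  grind

/-- It serves in contrapositive form: if (α β) is not an up step, removing a commuting top label
does not make it one. -/
theorem UpStep.of_comm (h₁ : UpStep (x * Equiv.swap γ δ) α β) (h₂ : DownStep x γ δ)
    (h : β < γ ∨ δ < α ∨ (α < γ ∧ δ < β) ∨ (γ < α ∧ β < δ)) :
    UpStep x α β := by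
  obtain ⟨a1, a2, a3, a4⟩ := h₁
  obtain ⟨b1, b2, b3, b4⟩ := h₂
  simp only [mul_swap_apply] at a2 a3 a4
  refine ⟨a1, by grind, by grind, fun ε h1 h2 => ?_⟩
  have := a4 ε
  have := a4 γ
  have := a4 δ
  grind

/-- Together with the two given down steps, these say that either side of relation 1 can be stripped
from the top of the chain, letter by letter. The assumptions on α are those supplied by
`exists_left_of_shared_left`. -/
theorem DownStep.shared_left (h₁ : DownStep x β γ) (h₂ : DownStep x β δ) (hγδ : γ < δ)
    (hlow : ∀ i, i < γ → i ≤ x i) (hmid : ∀ i, β < i → i < γ → x i < γ) (hαβ : α < β)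
    (a1 : x δ ≤ α) (a2 : γ ≤ x α) (a3 : ∀ i, α < i → i < β → x i < γ) :
    DownStep (x * Equiv.swap β γ) γ δ ∧
      DownStep (x * Equiv.swap β γ * Equiv.swap γ δ) α γ ∧
      DownStep (x * Equiv.swap β δ) α β ∧
      DownStep (x * Equiv.swap β δ * Equiv.swap α β) β γ := by
  obtain ⟨hβγ, b2, b3, b4⟩ := h₁
  obtain ⟨hβδ, c2, c3, c4⟩ := h₂
  have hαγ := hαβ.trans hβγ
  have hαδ := hαβ.trans hβδ
  have hc := c4 γ hβγ hγδ
  refine ⟨?_, ?_, ?_, ?_⟩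
  · obtain ⟨y1, y2, y3⟩ := mul_swap_eqs x β γ
    refine ⟨hγδ, ?_, ?_, fun ε h1 h2 => ?_⟩
    · rw [y3 δ hβδ.ne' hγδ.ne']; exact c2.trans hβγ.le
    · rwa [y2]
    · rw [y3 δ hβδ.ne' hγδ.ne', y2, y3 ε (hβγ.trans h1).ne' h1.ne']
      exact c4 ε (hβγ.trans h1) h2
  · obtain ⟨y1, y2, y3⟩ := mul_swap_eqs x β γ
    obtain ⟨z1, z2, z3⟩ := mul_swap_eqs (x * Equiv.swap β γ) γ δ
    have zα := (z3 α hαγ.ne hαδ.ne).trans (y3 α hαβ.ne hαγ.ne)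
    have zγ := z1.trans (y3 δ hβδ.ne' hγδ.ne')
    have zβ := (z3 β hβγ.ne hβδ.ne).trans y1
    refine ⟨hαγ, by rwa [zγ], by rwa [zα], fun ε h1 h2 => ?_⟩
    rw [zα, zγ]
    rcases lt_trichotomy ε β with h | rfl | h
    · rw [z3 ε h2.ne (h2.trans hγδ).ne, y3 ε h.ne h2.ne]
      exact ⟨a1.trans_lt (h1.trans_le (hlow ε h2)), (a3 ε h1 h).trans_le a2⟩
    · rw [zβ]
      exact ⟨hc.1, (b2.trans_lt hβγ).trans_le a2⟩
    · rw [z3 ε h2.ne (h2.trans hγδ).ne, y3 ε h.ne' h2.ne]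
      exact ⟨(c4 ε h (h2.trans hγδ)).1, (hmid ε h h2).trans_le a2⟩
  · obtain ⟨y1, y2, y3⟩ := mul_swap_eqs x β δ
    have yα := y3 α hαβ.ne hαδ.ne
    refine ⟨hαβ, by rwa [y1], by rw [yα]; exact hβγ.le.trans a2, fun ε h1 h2 => ?_⟩
    rw [y1, yα, y3 ε h2.ne (h2.trans hβδ).ne]
    exact ⟨a1.trans_lt (h1.trans_le (hlow ε (h2.trans hβγ))), (a3 ε h1 h2).trans_le a2⟩
  · obtain ⟨y1, y2, y3⟩ := mul_swap_eqs x β δ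
    obtain ⟨z1, z2, z3⟩ := mul_swap_eqs (x * Equiv.swap β δ) α β
    have zβ := z2.trans (y3 α hαβ.ne hαδ.ne)
    have zγ := (z3 γ hαγ.ne' hβγ.ne').trans (y3 γ hβγ.ne' hγδ.ne)
    refine ⟨hβγ, by rwa [zγ], by rwa [zβ], fun ε h1 h2 => ?_⟩
    rw [zβ, zγ, z3 ε (hαβ.trans h1).ne' h1.ne', y3 ε h1.ne' (h2.trans hγδ).ne]
    exact ⟨(b4 ε h1 h2).1, (hmid ε h1 h2).trans_le a2⟩

/-- This is the analogue for the two sides of relation 2, with δ from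
`exists_right_of_shared_right`. -/
theorem DownStep.shared_right (h₁ : DownStep x α γ) (h₂ : DownStep x β γ) (hαβ : α < β)
    (hlow : ∀ i, i < γ → i ≤ x i) (hhigh : ∀ i, γ < i → x i ≤ i) (hγδ : γ < δ)
    (a1 : δ ≤ x α) (a2 : x δ ≤ β) (a3 : ∀ i, γ < i → i < δ → β < x i) :
    DownStep (x * Equiv.swap α γ) γ δ ∧
      DownStep (x * Equiv.swap α γ * Equiv.swap γ δ) β γ ∧
      DownStep (x * Equiv.swap β γ) α β ∧
      DownStep (x * Equiv.swap β γ * Equiv.swap α β) β δ := by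
  obtain ⟨hαγ, b2, b3, b4⟩ := h₁
  obtain ⟨hβγ, c2, c3, c4⟩ := h₂
  have hαδ := hαγ.trans hγδ
  have hβδ := hβγ.trans hγδ
  have hb := b4 β hαβ hβγ
  refine ⟨?_, ?_, ?_, ?_⟩
  · obtain ⟨y1, y2, y3⟩ := mul_swap_eqs x α γ
    have yδ := y3 δ hαδ.ne' hγδ.ne'
    refine ⟨hγδ, by rw [yδ]; exact a2.trans hβγ.le, by rwa [y2], fun ε h1 h2 => ?_⟩
    rw [yδ, y2, y3 ε (hαγ.trans h1).ne' h1.ne']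
    exact ⟨a2.trans_lt (a3 ε h1 h2), ((hhigh ε h1).trans_lt h2).trans_le a1⟩
  · obtain ⟨y1, y2, y3⟩ := mul_swap_eqs x α γ
    obtain ⟨z1, z2, z3⟩ := mul_swap_eqs (x * Equiv.swap α γ) γ δ
    have zγ := z1.trans (y3 δ hαδ.ne' hγδ.ne')
    have zβ := (z3 β hβγ.ne hβδ.ne).trans (y3 β hαβ.ne' hβγ.ne)
    refine ⟨hβγ, by rwa [zγ], by rwa [zβ], fun ε h1 h2 => ?_⟩
    rw [zγ, zβ, z3 ε h2.ne (h2.trans hγδ).ne, y3 ε (hαβ.trans h1).ne' h2.ne]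
    exact ⟨a2.trans_lt (h1.trans_le (hlow ε h2)), (c4 ε h1 h2).2⟩
  · obtain ⟨y1, y2, y3⟩ := mul_swap_eqs x β γ
    have yα := y3 α hαβ.ne hαγ.ne
    refine ⟨hαβ, by rwa [y1], by rw [yα]; exact hβγ.le.trans b3, fun ε h1 h2 => ?_⟩
    rw [y1, yα, y3 ε h2.ne (h2.trans hβγ).ne]
    exact b4 ε h1 (h2.trans hβγ)
  · obtain ⟨y1, y2, y3⟩ := mul_swap_eqs x β γ
    obtain ⟨z1, z2, z3⟩ := mul_swap_eqs (x * Equiv.swap β γ) α β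
    have zβ := z2.trans (y3 α hαβ.ne hαγ.ne)
    have zδ := (z3 δ hαδ.ne' hβδ.ne').trans (y3 δ hβδ.ne' hγδ.ne')
    have zγ := (z3 γ hαγ.ne' hβγ.ne').trans y2
    refine ⟨hβδ, by rwa [zδ], by rwa [zβ], fun ε h1 h2 => ?_⟩
    rw [zβ, zδ]
    rcases lt_trichotomy ε γ with h | rfl | h
    · rw [z3 ε (hαβ.trans h1).ne' h1.ne', y3 ε h1.ne' h.ne]
      exact ⟨a2.trans_lt (h1.trans_le (hlow ε h)), (b4 ε (hαβ.trans h1) h).2⟩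
    · rw [zγ]
      exact ⟨a2.trans_lt (h1.trans_le c3), hb.2⟩
    · rw [z3 ε (hαβ.trans h1).ne' h1.ne', y3 ε h1.ne' h.ne']
      exact ⟨a2.trans_lt (a3 ε h h2), ((hhigh ε h).trans_lt h2).trans_le a1⟩

theorem transp_mul_inv_val (ζ : SInf) (a b : ℕ+) :
    (transp a b * ζ)⁻¹.1 = ζ⁻¹.1 * Equiv.swap a b := by
  rw [mul_inv_rev, transp_inv]
  rfl

theorem DownStep.isPath_cons {ζ : SInf} {w : List GenIdx} (h : DownStep ζ⁻¹.1 α β)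
    (hw : IsPath 1 w (transp α β * ζ)) : IsPath 1 (genIdx h.1 :: w) ζ :=
  ⟨_, hw, h.isPath, by
    change ζ = transp α β * (transp α β * ζ)
    rw [← mul_assoc, transp_mul_self, one_mul]⟩

theorem IsPath.downStep_of_cons {η ζ : SInf} {g : GenIdx} {w : List GenIdx}
    (h : IsPath η (g :: w) ζ) :
    DownStep ζ⁻¹.1 g.1.1 g.1.2 ∧ IsPath η w (transp g.1.1 g.1.2 * ζ) := by
  obtain ⟨ξ, h1, h2, rfl⟩ := h
  rw [transp_mul_inv_val, ← mul_assoc, transp_mul_self, one_mul]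
  exact ⟨downStep_mul_swap.2 h2, h1⟩

end DownSteps

/-! ### All chains to ζ have the same value in the monoid -/

/-- Some chain to `ζ` ending with `g` and some chain to `ζ` ending with `g'` have words with the
same value in the presented monoid. -/
def Linked (ζ : SInf) (g g' : GenIdx) : Prop :=
  ∃ p p', IsPath 1 (g :: p) ζ ∧ IsPath 1 (g' :: p') ζ ∧ wordM (g :: p) = wordM (g' :: p')

/-- All chains to `ζ` have words with the same value in the presented monoid. -/
def HasUniqueWord (ζ : SInf) : Prop :=
  ∀ w w', IsPath 1 w ζ → IsPath 1 w' ζ → wordM w = wordM w'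

section Linking

variable {ζ : SInf} {α β γ δ : ℕ+}

theorem Linked.symm {g g' : GenIdx} (h : Linked ζ g g') : Linked ζ g' g := by
  obtain ⟨p, p', h1, h2, h3⟩ := h
  exact ⟨p', p, h2, h1, h3.symm⟩

theorem rankU_lt_of_cons {g : GenIdx} {v : List GenIdx} (hv : IsPath 1 (g :: v) ζ) :
    rankU (transp g.1.1 g.1.2 * ζ) < rankU ζ := by
  rw [rankU_eq hv, rankU_eq hv.downStep_of_cons.2, List.length_cons]
  omega

theorem wordM_cons_eq (ih : ∀ ξ, rankU ξ < rankU ζ → HasUniqueWord ξ) {g : GenIdx}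
    {v v' : List GenIdx} (hv : IsPath 1 (g :: v) ζ) (hv' : IsPath 1 (g :: v') ζ) :
    wordM (g :: v) = wordM (g :: v') := by
  rw [wordM_cons, wordM_cons,
    ih _ (rankU_lt_of_cons hv) _ _ hv.downStep_of_cons.2 hv'.downStep_of_cons.2]

/-- By induction on rank, chains with the same top letter agree, so one linked pair compares all
chains with the two given top letters. -/
theorem Linked.wordM_eq (ih : ∀ ξ, rankU ξ < rankU ζ → HasUniqueWord ξ) {g g' : GenIdx}
    (h : Linked ζ g g') {v v' : List GenIdx} (hv : IsPath 1 (g :: v) ζ)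
    (hv' : IsPath 1 (g' :: v') ζ) : wordM (g :: v) = wordM (g' :: v') := by
  obtain ⟨p, p', h1, h2, h3⟩ := h
  rw [wordM_cons_eq ih hv h1, h3, wordM_cons_eq ih h2 hv']

theorem linked_comm (h₁ : DownStep ζ⁻¹.1 α β) (h₂ : DownStep ζ⁻¹.1 γ δ)
    (h : β < γ ∨ δ < α ∨ (α < γ ∧ δ < β) ∨ (γ < α ∧ β < δ)) :
    Linked ζ (genIdx h₁.1) (genIdx h₂.1) := by
  have d1 := h₁.comm h₂ h
  have d2 := h₂.comm h₁ (by tauto)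
  rw [← transp_mul_inv_val] at d1 d2
  obtain ⟨q, hq⟩ := exists_isPath_one (transp γ δ * (transp α β * ζ))
  have e : transp γ δ * (transp α β * ζ) = transp α β * (transp γ δ * ζ) := by
    rw [← mul_assoc, ← mul_assoc, transp_comm h₁.1 h₂.1 h]
  refine ⟨_, _, h₁.isPath_cons (d1.isPath_cons hq), h₂.isPath_cons (d2.isPath_cons (e ▸ hq)), ?_⟩
  simp only [wordM_cons, ← mul_assoc]
  rw [gen_comm h₁.1 h₂.1 h]

theorem linked_shared_left (h₁ : DownStep ζ⁻¹.1 β γ) (h₂ : DownStep ζ⁻¹.1 β δ) (hγδ : γ < δ)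
    (hlow : ∀ i, i < γ → i ≤ ζ⁻¹.1 i) (hmid : ∀ i, β < i → i < γ → ζ⁻¹.1 i < γ) :
    Linked ζ (genIdx h₁.1) (genIdx h₂.1) := by
  obtain ⟨α, hαβ, a1, a2, a3⟩ := exists_left_of_shared_left hlow hmid h₁ h₂ hγδ
  have hβγ := h₁.1
  obtain ⟨c1, c2, d1, d2⟩ := h₁.shared_left h₂ hγδ hlow hmid hαβ a1 a2 a3
  simp only [← transp_mul_inv_val] at c1 c2 d1 d2
  obtain ⟨q, hq⟩ := exists_isPath_one (transp α γ * (transp γ δ * (transp β γ * ζ)))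
  -- Stripping letters from ζ multiplies them in reverse order, which turns the permutation identity
  -- of relation 1 into that of relation 2.
  have e : transp α γ * (transp γ δ * (transp β γ * ζ)) =
      transp β γ * (transp α β * (transp β δ * ζ)) := by
    simp only [← mul_assoc]
    rw [transp_shared_right hαβ hβγ hγδ]
  refine ⟨_, _, h₁.isPath_cons (c1.isPath_cons (c2.isPath_cons hq)),
    h₂.isPath_cons (d1.isPath_cons (d2.isPath_cons (e ▸ hq))), ?_⟩
  simp only [wordM_cons, ← mul_assoc]
  rw [gen_shared_left hαβ hβγ hγδ]

theorem linked_shared_right (h₁ : DownStep ζ⁻¹.1 α γ) (h₂ : DownStep ζ⁻¹.1 β γ) (hαβ : α < β)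
    (hlow : ∀ i, i < γ → i ≤ ζ⁻¹.1 i) (hhigh : ∀ i, γ < i → ζ⁻¹.1 i ≤ i) :
    Linked ζ (genIdx h₁.1) (genIdx h₂.1) := by
  obtain ⟨δ, hγδ, a1, a2, a3⟩ := exists_right_of_shared_right hlow hhigh h₁ h₂ hαβ
  have hβγ := h₂.1
  obtain ⟨c1, c2, d1, d2⟩ := h₁.shared_right h₂ hαβ hlow hhigh hγδ a1 a2 a3
  simp only [← transp_mul_inv_val] at c1 c2 d1 d2
  obtain ⟨q, hq⟩ := exists_isPath_one (transp β γ * (transp γ δ * (transp α γ * ζ)))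
  have e : transp β γ * (transp γ δ * (transp α γ * ζ)) =
      transp β δ * (transp α β * (transp β γ * ζ)) := by
    simp only [← mul_assoc]
    rw [transp_shared_left hαβ hβγ hγδ]
  refine ⟨_, _, h₁.isPath_cons (c1.isPath_cons (c2.isPath_cons hq)),
    h₂.isPath_cons (d1.isPath_cons (d2.isPath_cons (e ▸ hq))), ?_⟩
  simp only [wordM_cons, ← mul_assoc]
  rw [gen_shared_right hαβ hβγ hγδ]

theorem inv_val_ne_one (h : ζ ≠ 1) : ζ⁻¹.1 ≠ 1 := fun e =>
  h (inv_eq_one.1 (Subtype.ext e))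

theorem hasUniqueWord (ζ : SInf) : HasUniqueWord ζ := by
  induction hn : rankU ζ using Nat.strong_induction_on generalizing ζ with
  | _ n ih =>
    replace ih : ∀ ξ, rankU ξ < rankU ζ → HasUniqueWord ξ := fun ξ h => ih _ (hn ▸ h) ξ rfl
    clear hn n
    by_cases hζ : ζ = 1
    · subst hζ
      have key : ∀ w, IsPath 1 w 1 → w = [] := fun w hw =>
        List.eq_nil_of_length_eq_zero ((rankU_eq hw).symm.trans rankU_one)
      intro w w' hw hw'
      rw [key w hw, key w' hw']
    -- The leftmost down step is the label with which every other top label is compared.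
    obtain ⟨α₀, β₀, h₀, hβ, hlow, hmid⟩ := exists_leftmost_downStep (inv_val_ne_one hζ)
    obtain ⟨v₀, hv₀⟩ := exists_isPath_one (transp α₀ β₀ * ζ)
    have p₀ := h₀.isPath_cons hv₀
    suffices key : ∀ g v, IsPath 1 (g :: v) ζ → wordM (g :: v) = wordM (genIdx h₀.1 :: v₀) by
      intro w w' hw hw'
      cases w with
      | nil => exact absurd (show ζ = 1 from hw) hζ
      | cons g v =>
        cases w' with
        | nil => exact absurd (show ζ = 1 from hw') hζ
        | cons g' v' => rw [key g v hw, key g' v' hw']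
    intro g v hv
    obtain ⟨⟨α, β⟩, hαβ⟩ := g
    have hd : DownStep ζ⁻¹.1 α β := hv.downStep_of_cons.1
    change IsPath 1 (genIdx hd.1 :: v) ζ at hv
    change wordM (genIdx hd.1 :: v) = _
    have hββ : β₀ ≤ β := by
      by_contra h
      have := hlow β (not_le.1 h)
      exact absurd (this.trans hd.2.1) (not_le.2 hαβ)
    rcases hββ.eq_or_lt with rfl | hββ
    · rcases lt_trichotomy α α₀ with hαα | rfl | hαα
      -- For two labels ending at β₀, relation 2 needs x i ≤ i beyond β₀. When this fails, the
      -- rightmost down step lies to the right of β₀, commutes with both labels and links them.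
      · obtain ⟨N, hN⟩ := exists_bound ζ⁻¹
        obtain ⟨α', β', h', hα', hhigh, -⟩ :=
          exists_rightmost_downStep (inv_val_ne_one hζ) hN
        rcases lt_trichotomy β₀ α' with hc | rfl | hc
        · obtain ⟨v', hv'⟩ := exists_isPath_one (transp α' β' * ζ)
          have p' := h'.isPath_cons hv'
          rw [(linked_comm hd h' (Or.inl hc)).wordM_eq ih hv p',
            (linked_comm h₀ h' (Or.inl hc)).symm.wordM_eq ih p' p₀]
        · exact absurd hα' (lt_asymm hβ)
        · exact (linked_shared_right hd h₀ hαα hlow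
            (fun i hi => hhigh i (hc.trans hi))).wordM_eq ih hv p₀
      · exact wordM_cons_eq ih hv p₀
      · exact absurd (hmid α hαα hαβ) (not_lt.2 hd.2.2.1)
    · rcases lt_trichotomy β₀ α with hc | rfl | hc
      · exact (linked_comm hd h₀ (Or.inr (Or.inl hc))).wordM_eq ih hv p₀
      · exact absurd (hd.2.2.1.trans_lt hβ) (not_lt.2 hαβ.le)
      · rcases lt_trichotomy α α₀ with hαα | rfl | hαα
        · exact (linked_comm hd h₀ (by tauto)).wordM_eq ih hv p₀
        · exact (linked_shared_left h₀ hd hββ hlow hmid).symm.wordM_eq ih hv p₀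
        · exact absurd (hββ.trans_le hd.2.2.1) (lt_asymm (hmid α hαα hc))

end Linking

/-! ### Words without a chain vanish -/

theorem not_isPath_cons {g : GenIdx} {q : List GenIdx} {ξ : SInf} (hq : IsPath 1 q ξ)
    (h : ¬ UpStep ξ⁻¹.1 g.1.1 g.1.2) (σ : SInf) : ¬ IsPath 1 (g :: q) σ := by
  rintro ⟨ξ', h1, h2, -⟩
  rw [h1.unique hq] at h2
  exact h h2

theorem not_isPath_cons_cons {g h : GenIdx} {q : List GenIdx} {ξ : SInf} (hq : IsPath 1 q ξ)
    (hn : ¬ UpStep (ξ⁻¹.1 * Equiv.swap h.1.1 h.1.2) g.1.1 g.1.2) (σ : SInf) :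
    ¬ IsPath 1 (g :: h :: q) σ := by
  rintro ⟨ξ', ⟨τ, h1, -, rfl⟩, h3, -⟩
  rw [h1.unique hq, transp_mul_inv_val] at h3
  exact hn h3

section Obstructions

variable {x : Equiv.Perm ℕ+} {α β γ δ : ℕ+}

theorem swap_mul_apply (x : Equiv.Perm ℕ+) (a b i : ℕ+) :
    (Equiv.swap a b * x) i = if x i = a then b else if x i = b then a else x i := by
  rw [← Equiv.swap_apply_def]
  rfl

/-- A second down step, when `(α β)` is not an up step because `α < x α`. -/
theorem exists_downStep_left (hαβ : α < β) (hα : α < x α) (h : DownStep x β γ)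
    (hlow : ∀ i, i < γ → i ≤ x i) (hγ : x γ ≤ α) :
    ∃ α', α ≤ α' ∧ DownStep (x * Equiv.swap β γ) α' β := by
  have hβγ := h.1
  have hex : ∃ i, α ≤ i ∧ i < β ∧ β ≤ x i := by
    by_contra hn
    push Not at hn
    -- Otherwise [α, β) would be mapped into itself without ever taking the value α.
    have hc : (Finset.Ico α β).card ≤ ((Finset.Ico α β).erase α).card := by
      apply card_le_of_mapsTo (x := x)
      intro i hi
      simp only [Finset.mem_Ico, Finset.mem_erase] at hi ⊢
      have h1 := hn i hi.1 hi.2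
      rcases hi.1.eq_or_lt with rfl | h2
      · exact ⟨hα.ne', hα.le, h1⟩
      · have h3 := h2.trans_le (hlow i (hi.2.trans hβγ))
        exact ⟨h3.ne', h3.le, h1⟩
    have hm : α ∈ Finset.Ico α β := Finset.mem_Ico.2 ⟨le_rfl, hαβ⟩
    rw [Finset.card_erase_of_mem hm] at hc
    have := Finset.card_pos.2 ⟨α, hm⟩
    omega
  obtain ⟨α', ⟨h1, h2, h3⟩, hmax⟩ := exists_greatest hex (fun i hi => hi.2.1.le)
  obtain ⟨y1, y2, y3⟩ := mul_swap_eqs x β γ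
  have yα := y3 α' h2.ne (h2.trans hβγ).ne
  refine ⟨α', h1, h2, ?_, ?_, fun ε e1 e2 => ?_⟩
  · rw [y1]; exact hγ.trans h1
  · rwa [yα]
  · rw [y1, yα, y3 ε e2.ne (e2.trans hβγ).ne]
    refine ⟨hγ.trans_lt (h1.trans_lt (e1.trans_le (hlow ε (e2.trans hβγ)))), lt_of_lt_of_le ?_ h3⟩
    by_contra hc
    exact hmax ε e1 ⟨h1.trans e1.le, e2, not_lt.1 hc⟩

/-- A second down step, when `(α β)` is not an up step because `x β < β`. -/
theorem exists_downStep_right (hαβ : α < β) (hβ : x β < β) (h : DownStep x γ α)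
    (hhigh : ∀ i, γ < i → x i ≤ i) (hγ : β ≤ x γ) :
    ∃ β', β' ≤ β ∧ DownStep (x * Equiv.swap γ α) α β' := by
  have hγα := h.1
  have hex : ∃ i, α < i ∧ i ≤ β ∧ x i ≤ α := by
    by_contra hn
    push Not at hn
    have hc : (Finset.Ioc α β).card ≤ ((Finset.Ioc α β).erase β).card := by
      apply card_le_of_mapsTo (x := x)
      intro i hi
      simp only [Finset.mem_Ioc, Finset.mem_erase] at hi ⊢
      have h1 := hn i hi.1 hi.2
      rcases hi.2.eq_or_lt with rfl | h2
      · exact ⟨hβ.ne, h1, hβ.le⟩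
      · have h3 := (hhigh i (hγα.trans hi.1)).trans_lt h2
        exact ⟨h3.ne, h1, h3.le⟩
    have hm : β ∈ Finset.Ioc α β := Finset.mem_Ioc.2 ⟨hαβ, le_rfl⟩
    rw [Finset.card_erase_of_mem hm] at hc
    have := Finset.card_pos.2 ⟨β, hm⟩
    omega
  obtain ⟨β', ⟨h1, h2, h3⟩, hmin⟩ := exists_least hex
  obtain ⟨y1, y2, y3⟩ := mul_swap_eqs x γ α
  have yβ := y3 β' (hγα.trans h1).ne' h1.ne'
  refine ⟨β', h2, h1, ?_, ?_, fun ε e1 e2 => ?_⟩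
  · rwa [yβ]
  · rw [y2]; exact h2.trans hγ
  · rw [y2, yβ, y3 ε (hγα.trans e1).ne' e1.ne']
    refine ⟨lt_of_le_of_lt h3 ?_, ((hhigh ε (hγα.trans e1)).trans_lt e2).trans_le (h2.trans hγ)⟩
    by_contra hc
    exact hmin ε e2 ⟨e1, e2.le.trans h2, not_lt.1 hc⟩

/-- Removing an atom (a b) from ζ exchanges the values a and b of ζ⁻¹. A bound that fails for the
value m but holds after the exchange forces m = b, and so locates a. -/
theorem le_of_swapped_le {a b m : ℕ+} (hab : a < b) (hm : α < m)
    (h : (if m = a then b else if m = b then a else m) ≤ α) : a ≤ α := by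
  grind

theorem le_of_le_swapped {a b m : ℕ+} (hab : a < b) (hm : m < β)
    (h : β ≤ if m = a then b else if m = b then a else m) : β ≤ b := by
  grind

theorem swapped_le_swapped_of_le {a b m e : ℕ+} (hab : a < b) (hem : e < m) (hm : m ≤ a) :
    (if e = a then b else if e = b then a else e) ≤
      if m = a then b else if m = b then a else m := by
  grind

theorem swapped_le_swapped_of_ge {a b m e : ℕ+} (hab : a < b) (hem : m < e) (hm : b ≤ m) :
    (if m = a then b else if m = b then a else m) ≤
      if e = a then b else if e = b then a else e := by
  grind

end Obstructions

/-- Words without a chain vanish in the presented monoid. -/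
theorem wordM_eq_zero {w : List GenIdx} (hw : ∀ ζ, ¬ IsPath 1 w ζ) : wordM w = 0 := by
  induction hn : w.length using Nat.strong_induction_on generalizing w with
  | _ n ih =>
  replace ih : ∀ v : List GenIdx, v.length < w.length → (∀ ζ, ¬ IsPath 1 v ζ) → wordM v = 0 :=
    fun v hv h => ih _ (hn ▸ hv) h rfl
  clear hn n
  cases w with
  | nil => exact absurd rfl (hw 1)
  | cons g v =>
  by_cases hv : ∃ ζ, IsPath 1 v ζ
  swap
  · rw [wordM_cons, ih v (by simp) (not_exists.1 hv), mul_zero]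
  obtain ⟨ζ, hv⟩ := hv
  have hg : ¬ UpStep ζ⁻¹.1 g.1.1 g.1.2 := fun h => hw _ ⟨ζ, hv, h, rfl⟩
  obtain ⟨⟨α, β⟩, hαβ⟩ := g
  change α < β at hαβ
  change ¬ UpStep ζ⁻¹.1 α β at hg
  by_contra hne
  -- By uniqueness of words, v can be replaced by any chain to ζ.
  have hrep : ∀ v', IsPath 1 v' ζ → wordM (genIdx hαβ :: v') ≠ 0 := by
    intro v' hv' h0
    apply hne
    rw [wordM_cons] at h0 ⊢
    rw [hasUniqueWord ζ v v' hv hv']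
    exact h0
  have hlen : ∀ v', IsPath 1 v' ζ → v'.length = v.length := fun v' hv' =>
    (rankU_eq hv').symm.trans (rankU_eq hv)
  have hζ : ζ ≠ 1 := by
    rintro rfl
    apply hg
    simp only [UpStep, one_inv_apply]
    exact ⟨hαβ, le_rfl, le_rfl, fun γ h h' => ⟨h, h'⟩⟩
  -- A top label that does not abut (α β) either commutes with it, and a shorter word vanishes by
  -- induction, or crosses it, and relation 4 applies.
  have htop : ∀ c d, DownStep ζ⁻¹.1 c d → c = β ∨ d = α := by
    intro c d hcd
    by_contra hcon
    push Not at hcon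
    obtain ⟨q, hq⟩ := exists_isPath_one (transp c d * ζ)
    have hp := hcd.isPath_cons hq
    have hl := hlen _ hp
    rw [List.length_cons] at hl
    apply hrep _ hp
    rw [wordM_cons, wordM_cons, ← mul_assoc]
    have hc := hcd.1
    by_cases hcomm : β < c ∨ d < α ∨ (α < c ∧ d < β) ∨ (c < α ∧ β < d)
    · rw [gen_comm hαβ hc hcomm, mul_assoc, ← wordM_cons, ih (genIdx hαβ :: q), mul_zero]
      · simp [hl]
      · refine not_isPath_cons hq fun hu => hg ?_
        rw [transp_mul_inv_val] at hu
        exact hu.of_comm hcd hcomm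
    · rw [gen_cross hαβ hc (by grind), zero_mul]
  -- Splitting off the bottom letter leaves a shorter word, which by induction can be nonzero only
  -- if (α β) is an up step there.
  have hatom : ∀ a b, DownStep ζ.1 a b → UpStep (Equiv.swap a b * ζ⁻¹.1) α β := by
    intro a b hab
    by_contra hcon
    obtain ⟨v', h1, h2⟩ := exists_isPath_concat (g := genIdx hab.1) hab
    have hl := hlen _ h2
    rw [List.length_append, List.length_singleton] at hl
    apply hrep _ h2
    rw [← List.cons_append, wordM_append, ih (genIdx hαβ :: v'), zero_mul]
    · simp [hl.symm]
    · refine not_isPath_cons h1 fun hu => hcon ?_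
      rw [mul_inv_rev, transp_inv] at hu
      exact hu
  obtain ⟨N, hN⟩ := exists_bound ζ⁻¹
  obtain ⟨N', hN'⟩ := exists_bound ζ
  obtain ⟨c₀, d₀, ht₀, hd₀, hlow, -⟩ := exists_leftmost_downStep (inv_val_ne_one hζ)
  obtain ⟨c₁, d₁, ht₁, hc₁, hhigh, -⟩ := exists_rightmost_downStep (inv_val_ne_one hζ) hN
  have hζ' : ζ.1 ≠ 1 := fun e => hζ (Subtype.ext e)
  obtain ⟨a₀, b₀, hs₀, -, hmin, -⟩ := exists_leftmost_downStep hζ'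
  obtain ⟨a₁, b₁, hs₁, -, hmax, -⟩ := exists_rightmost_downStep hζ' hN'
  have hat₀ := hatom _ _ hs₀
  have hat₁ := hatom _ _ hs₁
  -- The extremal position of the two atoms is restated for the values of ζ⁻¹.
  have hmin : ∀ i, i < ζ⁻¹.1 i → b₀ ≤ ζ⁻¹.1 i := by
    intro i hi
    by_contra hcon
    have := hmin _ (not_le.1 hcon)
    rw [val_inv_apply] at this
    exact absurd hi (not_lt.2 this)
  have hmax : ∀ i, ζ⁻¹.1 i < i → ζ⁻¹.1 i ≤ a₁ := by
    intro i hi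
    by_contra hcon
    have := hmax _ (not_le.1 hcon)
    rw [val_inv_apply] at this
    exact absurd hi (not_lt.2 this)
  have hab₀ := hs₀.1
  have hab₁ := hs₁.1
  simp only [UpStep, swap_mul_apply] at hat₀ hat₁
  obtain ⟨-, -, p₃, p₄⟩ := hat₀
  obtain ⟨-, q₂, -, q₄⟩ := hat₁
  by_cases hα : α < ζ⁻¹.1 α
  -- The leftmost top label ends at a lowered position, hence not at α, so it starts at β. The
  -- rightmost atom bounds the value at its other end by α.
  · rcases htop _ _ ht₀ with rfl | rfl
    swap
    · exact lt_asymm hα hd₀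
    have ha := le_of_swapped_le hab₁ hα q₂
    have hγ := (hmax _ hd₀).trans ha
    obtain ⟨α', h1, h2⟩ := exists_downStep_left hαβ hα ht₀ hlow hγ
    have hβγ := ht₀.1
    rw [← transp_mul_inv_val] at h2
    obtain ⟨q, hq⟩ := exists_isPath_one (transp α' c₀ * (transp c₀ d₀ * ζ))
    have hp := ht₀.isPath_cons (h2.isPath_cons hq)
    have hl := hlen _ hp
    simp only [List.length_cons] at hl
    apply hrep _ hp
    simp only [wordM_cons, ← mul_assoc]
    rcases h1.eq_or_lt with rfl | h1
    -- If α' = α, the product vanishes by relation 5. Otherwise relation 2 brings (α α') to the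
    -- second place, where the violation α < x α persists, and a shorter word vanishes by induction.
    · rw [gen_braid' hαβ hβγ, zero_mul]
    · rw [gen_shared_right h1 h2.1 hβγ, mul_assoc, mul_assoc, ← wordM_cons, ← wordM_cons,
        ih, mul_zero]
      · simp [hl]
      · refine not_isPath_cons_cons hq fun hu => ?_
        have h3 := hu.2.1
        simp only [genIdx, mul_swap_apply, transp_mul_inv_apply, h1.ne, hαβ.ne,
          (hαβ.trans hβγ).ne, if_false] at h3
        exact absurd hα (not_lt.2 h3)
  -- This is the mirror image, with the rightmost top label, the leftmost atom and relation 1.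
  by_cases hβ : ζ⁻¹.1 β < β
  · rcases htop _ _ ht₁ with rfl | rfl
    · exact lt_asymm hβ hc₁
    have hb := le_of_le_swapped hab₀ hβ p₃
    have hγ := hb.trans (hmin _ hc₁)
    obtain ⟨β', h1, h2⟩ := exists_downStep_right hαβ hβ ht₁ hhigh hγ
    have hγα := ht₁.1
    rw [← transp_mul_inv_val] at h2
    obtain ⟨q, hq⟩ := exists_isPath_one (transp d₁ β' * (transp c₁ d₁ * ζ))
    have hp := ht₁.isPath_cons (h2.isPath_cons hq)
    have hl := hlen _ hp
    simp only [List.length_cons] at hl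
    apply hrep _ hp
    simp only [wordM_cons, ← mul_assoc]
    rcases h1.eq_or_lt with rfl | h1
    · rw [gen_braid hγα hαβ, zero_mul]
    · rw [← gen_shared_left hγα h2.1 h1, mul_assoc, mul_assoc, ← wordM_cons, ← wordM_cons,
        ih, mul_zero]
      · simp [hl]
      · refine not_isPath_cons_cons hq fun hu => ?_
        have h3 := hu.2.2.1
        simp only [genIdx, mul_swap_apply, transp_mul_inv_apply, h1.ne', hαβ.ne',
          (hγα.trans hαβ).ne', if_false] at h3
        exact absurd hβ (not_lt.2 h3)
  apply hg
  refine ⟨hαβ, not_lt.1 hα, not_lt.1 hβ, fun ε h1 h2 => ⟨?_, ?_⟩⟩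
  · by_contra hcon
    have hne : ζ⁻¹.1 ε ≠ ζ⁻¹.1 α := fun e => h1.ne' (ζ⁻¹.1.injective e)
    have hlt := lt_of_le_of_ne (not_lt.1 hcon) hne
    have hε : ζ⁻¹.1 ε < ε := (hlt.trans_le (not_lt.1 hα)).trans h1
    -- Only betweenness can still fail. A lowered ε left of β excludes a leftmost top label starting
    -- at β. If that label ends at α, then x α ≤ a₁, and removing the atom (a₁ b₁) cannot repair the
    -- order of x ε and x α.
    rcases htop _ _ ht₀ with rfl | rfl
    · exact absurd (hlow ε (h2.trans ht₀.1)) (not_le.2 hε)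
    · have h3 := hmax _ hd₀
      exact absurd (q₄ ε h1 h2).1 (not_lt.2 (swapped_le_swapped_of_le hab₁ hlt h3))
  · by_contra hcon
    have hne : ζ⁻¹.1 ε ≠ ζ⁻¹.1 β := fun e => h2.ne (ζ⁻¹.1.injective e)
    have hlt := lt_of_le_of_ne (not_lt.1 hcon) hne.symm
    have hε : ε < ζ⁻¹.1 ε := h2.trans_le ((not_lt.1 hβ).trans hlt.le)
    rcases htop _ _ ht₁ with rfl | rfl
    · have h3 := hmin _ hc₁
      exact absurd (p₄ ε h1 h2).2 (not_lt.2 (swapped_le_swapped_of_ge hab₀ hlt h3))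
    · exact absurd (hhigh ε (ht₁.1.trans h1)) (not_le.2 hε)

/-! ### The faithful representation -/

theorem MRel.map {N N' : Type*} [MonoidWithZero N] [MonoidWithZero N'] (f : N →*₀ N')
    {v : GenIdx → N} {X Y : N} (h : MRel v X Y) : MRel (fun g => f (v g)) (f X) (f Y) := by
  cases h with
  | rel1 h₁ h₂ h₃ => simpa only [map_mul] using .rel1 h₁ h₂ h₃
  | rel2 h₁ h₂ h₃ => simpa only [map_mul] using .rel2 h₁ h₂ h₃
  | rel3 h₁ h₂ h => simpa only [map_mul] using .rel3 h₁ h₂ h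
  | rel4 h₁ h₂ h₃ => simpa only [map_mul, map_zero] using .rel4 h₁ h₂ h₃
  | rel4' h₁ h₂ h₃ => simpa only [map_mul, map_zero] using .rel4' h₁ h₂ h₃
  | rel5 h₁ h₂ => simpa only [map_mul, map_zero] using .rel5 h₁ h₂
  | rel5' h₁ h₂ => simpa only [map_mul, map_zero] using .rel5' h₁ h₂

/-- The representation of the free monoid with zero by the operators `û`. -/
noncomputable def freeRep : WithZero (FreeMonoid GenIdx) →*₀ Module.End ℚ QSInf :=
  WithZero.lift' (FreeMonoid.lift uHat)

theorem freeRep_freeGen (g : GenIdx) : freeRep (freeGen g) = uHat g := by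
  simp [freeRep, freeGen]

theorem mCon_le_ker : mCon ≤ Con.ker freeRep.toMonoidHom := by
  refine Con.conGen_le.2 fun X Y h => ?_
  have := h.map freeRep
  simp only [freeRep_freeGen] at this
  exact eq_of_mRel_uHat this

/-- The representation `x ↦ x̂` of the presented monoid. -/
noncomputable def monoidRep : MMonoid →*₀ Module.End ℚ QSInf where
  toFun := mCon.lift freeRep.toMonoidHom mCon_le_ker
  map_zero' := map_zero freeRep
  map_one' := map_one (mCon.lift freeRep.toMonoidHom mCon_le_ker)
  map_mul' := map_mul (mCon.lift freeRep.toMonoidHom mCon_le_ker)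

theorem monoidRep_gen (g : GenIdx) : monoidRep (MMonoid.gen g) = uHat g := freeRep_freeGen g

theorem monoidRep_wordM (w : List GenIdx) : monoidRep (wordM w) = hatWord w := by
  rw [wordM, hatWord, map_list_prod, List.map_map]
  congr 1

theorem mk_coe_eq_wordM (m : FreeMonoid GenIdx) :
    MMonoid.mk (m : WithZero (FreeMonoid GenIdx)) = wordM m.toList := by
  induction m using FreeMonoid.inductionOn' with
  | one => exact map_one MMonoid.mk
  | of_mul g m ih =>
    rw [WithZero.coe_mul, map_mul, ih, FreeMonoid.toList_of_mul, wordM_cons]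
    rfl

/-- This is the normal form: nonzero elements come from chains, and by `hasUniqueWord` only the end
of the chain matters. -/
theorem eq_zero_or_exists_isPath (x : MMonoid) :
    x = 0 ∨ ∃ w ζ, IsPath 1 w ζ ∧ x = wordM w := by
  obtain ⟨y, rfl⟩ := MMonoid.mk_surjective x
  induction y using WithZero.recZeroCoe with
  | zero => exact Or.inl rfl
  | coe m =>
    rw [mk_coe_eq_wordM]
    by_cases h : ∃ ζ, IsPath 1 m.toList ζ
    · obtain ⟨ζ, hζ⟩ := h
      exact Or.inr ⟨_, ζ, hζ, rfl⟩
    · exact Or.inl (wordM_eq_zero (not_exists.1 h))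

theorem monoidRep_basisVec_one_injective :
    Function.Injective fun x => monoidRep x (basisVec 1) := by
  intro x y h
  simp only at h
  rcases eq_zero_or_exists_isPath x with rfl | ⟨v, ζ, hv, rfl⟩ <;>
    rcases eq_zero_or_exists_isPath y with rfl | ⟨w, η, hw, rfl⟩
  · rfl
  · rw [monoidRep_wordM, hw.hatWord, map_zero] at h
    exact absurd h.symm (basisVec_ne_zero η)
  · rw [monoidRep_wordM, hv.hatWord, map_zero] at h
    exact absurd h (basisVec_ne_zero ζ)
  · rw [monoidRep_wordM, monoidRep_wordM, hv.hatWord, hw.hatWord] at h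
    cases basisVec_injective h
    exact hasUniqueWord ζ v w hv hw

theorem bijOn_monoidRep : Set.BijOn (fun x => monoidRep x (basisVec 1)) Set.univ
    (Set.range basisVec ∪ {0}) := by
  refine ⟨fun x _ => ?_, monoidRep_basisVec_one_injective.injOn, ?_⟩
  · rcases eq_zero_or_exists_isPath x with rfl | ⟨v, ζ, hv, rfl⟩
    · right
      simp
    · left
      exact ⟨ζ, by simp only [monoidRep_wordM, hv.hatWord]⟩
  · rintro _ (⟨ζ, rfl⟩ | h)
    · obtain ⟨w, hw⟩ := exists_isPath_one ζ
      exact ⟨wordM w, trivial, by simp only [monoidRep_wordM, hw.hatWord]⟩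
    · exact ⟨0, trivial, by simpa using (Set.mem_singleton_iff.1 h).symm⟩

theorem uble_iff_exists_monoidRep (η ζ : SInf) :
    UBLE η ζ ↔ ∃ x : MMonoid, basisVec ζ = monoidRep x (basisVec η) := by
  rw [uble_iff]
  constructor
  · rintro ⟨w, hw⟩
    exact ⟨wordM w, by rw [monoidRep_wordM, hw.hatWord]⟩
  · rintro ⟨x, hx⟩
    rcases eq_zero_or_exists_isPath x with rfl | ⟨w, -, -, rfl⟩
    · rw [map_zero] at hx
      exact absurd hx (basisVec_ne_zero ζ)
    · rw [monoidRep_wordM] at hx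
      exact ⟨w, hatWord_eq_basisVec_iff.1 hx.symm⟩

theorem theorem1p1 :
    -- (a) `ℓ_u` is well defined: suitable `u` and `k` exist, and their choice does not matter
    ((∀ ζ : SInf, ∃ (u : SInf) (k : ℕ), KLE k u (ζ * u)) ∧
      (∀ (ζ u : SInf) (k : ℕ), KLE k u (ζ * u) →
        permLength (ζ * u) = permLength u + rankU ζ)) ∧
    -- (b) the operators satisfy the relations; compositions are determined by their value at `1`
    ((∀ X Y : Module.End ℚ QSInf, MRel uHat X Y → X = Y) ∧
      (∀ w w' : List GenIdx,
        hatWord w = hatWord w' ↔ hatWord w (basisVec 1) = hatWord w' (basisVec 1))) ∧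
    -- the map `x ↦ x̂`
    (∃ ρ : MMonoid →*₀ Module.End ℚ QSInf, (∀ g, ρ (MMonoid.gen g) = uHat g) ∧
      -- (c) it is faithful
      Function.Injective ρ ∧
      -- (d) `x ↦ x̂ 1` is a bijection onto `S_∞ ∪ {0}`
      Set.BijOn (fun x => ρ x (basisVec 1)) Set.univ (Set.range basisVec ∪ {0}) ∧
      -- (e) description of the order by the monoid
      (∀ η ζ : SInf, UBLE η ζ ↔ ∃ x : MMonoid, basisVec ζ = ρ x (basisVec η))) ∧
    -- (e) the universal order is a partial order, ranked by `ℓ_u`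
    ((∀ η, UBLE η η) ∧ (∀ η ζ, UBLE η ζ → UBLE ζ η → η = ζ) ∧
      (∀ η ζ ξ, UBLE η ζ → UBLE ζ ξ → UBLE η ξ) ∧ IsRankedBy UBLE rankU) ∧
    -- (e) isomorphisms of intervals
    ((∀ (ζ u : SInf) (k : ℕ), KLE k u (ζ * u) →
        ∃ e : Subrel UBLE (· ∈ relInterval UBLE 1 ζ) ≃r
            Subrel (KLE k) (· ∈ relInterval (KLE k) u (ζ * u)),
          ∀ ξ, (e ξ : SInf) = (ξ : SInf) * u) ∧
      (∀ η ζ : SInf, UBLE η ζ →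
        ∃ e : Subrel UBLE (· ∈ relInterval UBLE 1 (ζ * η⁻¹)) ≃r
            Subrel UBLE (· ∈ relInterval UBLE η ζ),
          ∀ ξ, (e ξ : SInf) = (ξ : SInf) * η)) ∧
    -- (f) reduced sequences of `ζ` correspond to maximal chains of `[1, ζ]`
    (∀ ζ : SInf, Set.BijOn wordChain (reducedSeqs ζ) (maximalChains UBLE 1 ζ)) :=
  ⟨⟨exists_kle, fun _ _ _ h => permLength_eq_add_rankU h⟩,
    ⟨fun _ _ h => eq_of_mRel_uHat h, fun _ _ => hatWord_eq_iff⟩,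
    ⟨monoidRep, monoidRep_gen,
      fun _ _ h => monoidRep_basisVec_one_injective (congrArg (· (basisVec 1)) h),
      bijOn_monoidRep, uble_iff_exists_monoidRep⟩,
    ⟨uble_refl, fun _ _ => uble_antisymm, fun _ _ _ => uble_trans, isRankedBy_rankU⟩,
    ⟨fun _ _ _ h => exists_kInterval_iso h, fun _ _ h => exists_interval_iso h⟩,
    bijOn_wordChain⟩
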